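/- Let $A\in\mathbb{R}^{m\times n}$ have rank $r\ge 1$, let $s_i=A_{g(i)}$, $i=1,\dots,r$, be $r$ linearly independent rows of $A$ (the rows selected by the quantum Gram–Schmidt process QGSP), let $|s_i\rangle=s_i/\|s_i\|$, let $t_1,\dots,t_r$ be the orthonormal vectors obtained from $|s_1\rangle,\dots,|s_r\rangle$ by the Gram–Schmidt process, let $Z\in\mathbb{R}^{r\times r}$ be the matrix with $(t_1,\dots,t_r)=(|s_1\rangle,\dots,|s_r\rangle)Z$, and let $C=(\langle s_i|s_j\rangle)_{i,j}$, with least singular value $\sigma_{\min}(C)$. Let $v\in\mathbb{R}^n$ be a unit vector in the row space of $A$, let $0<\varepsilon<1$, and let copies of the state $|v\rangle$ and a unitary oracle $U_A$ with $U_A|i\rangle|0\rangle=|i\rangle|A_i\rangle$ for every nonzero row $A_i$ (and its inverse) be available, where $|A_i\rangle=\sum_j (A_{ij}/\|A_i\|)|j\rangle$. Read-out algorithm. (1) Estimate $|\langle v|t_i\rangle|^2$ for all $i$ by repeated SWAP tests on $|v\rangle$ and $|t_i\rangle$, as twice the observed frequency of the outcome $0$ minus $1$; let $k$ be an index with the largest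 estimate. (2) For all $i$, estimate $\tilde a_i=\langle t_k|v\rangle\langle v|t_i\rangle$ by repeating the following test: to a control qubit $|0\rangle$, to $|v\rangle$ and to $(|t_k\rangle|0\rangle+|t_i\rangle|1\rangle)/\sqrt2$ apply a Hadamard gate on the control qubit, a controlled swap of the two $n$-dimensional registers, and Hadamard gates on the control qubit and on the last qubit; measure these two qubits; the estimate is twice the observed frequency of equal outcomes minus $1$. Let $a$ be the vector of these estimates, normalized to Euclidean length $1$. (3) Output $x=Za$. Theorem. For every fixed failure probability $\delta\in(0,1)$ there is a constant $K$ depending only on $\delta$ such that the algorithm can be implemented, with numbers of repetitions and with state preparation circuits that depend only on $\delta,m,n,r,g,Z,\varepsilon$, in such a way that in every situation as above: (a) with every such oracle $U_A$, the circuits prepare exactly the states $|t_i\rangle$ and $(|t_k\rangle|0\rangle+|t_i\rangle|1\rangle)/\sqrt2$ that the tests need; (b) at most $K r^3\varepsilon^{-2}$ copies of $|v\rangle$ are used; (c) at most $K r^4\sigma_{\min}(C)^{-1/2}\varepsilon^{-2}$ queries to $U_A$ and $U_A^{-1}$ are made; (d) with probability at least $1-\delta$, $\big\|\sum_{i=1}^r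 x_i\,s_i/\|s_i\|-v\big\|_2\le\varepsilon$, where the global sign of $v$ is fixed by $\langle t_k|v\rangle>0$ (that is, $v$ is replaced by $\operatorname{sign}(\langle t_k|v\rangle)\,v$). -/

import Mathlib

open scoped Kronecker Matrix ENNReal InnerProductSpace

noncomputable section

namespace QReadout

/-! ### Pure states, unitary gates, measurement -/

/-- A pure state of a finite quantum register whose computational basis is labelled by `ι`. -/
structure QState (ι : Type) [Fintype ι] where
  amp : ι → ℂ
  norm_sq : ∑ i, ‖amp i‖ ^ 2 = 1

namespace QState

variable {ι κ : Type} [Fintype ι] [Fintype κ]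

/-- The computational basis state `|i⟩`. -/
def basis [DecidableEq ι] (i : ι) : QState ι where
  amp := fun j => if j = i then 1 else 0
  norm_sq := by
    rw [Finset.sum_eq_single i]
    · simp
    · intro j _ hj; simp [hj]
    · simp

/-- The product state `|ψ⟩|φ⟩`. -/
def tensor (ψ : QState ι) (φ : QState κ) : QState (ι × κ) where
  amp := fun p => ψ.amp p.1 * φ.amp p.2
  norm_sq := by
    simp only [norm_mul, mul_pow, Fintype.sum_prod_type]
    simp only [← Finset.mul_sum, φ.norm_sq, mul_one, ψ.norm_sq]

theorem sum_norm_sq_mulVec [DecidableEq ι] (U : Matrix.unitaryGroup ι ℂ) (x : ι → ℂ) :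
    ∑ i, ‖((U : Matrix ι ι ℂ) *ᵥ x) i‖ ^ 2 = ∑ i, ‖x i‖ ^ 2 := by
  have key : ∀ y : ι → ℂ, ((∑ i, ‖y i‖ ^ 2 : ℝ) : ℂ) = star y ⬝ᵥ y := by
    intro y
    simp only [dotProduct, Pi.star_apply, Complex.ofReal_sum]
    refine Finset.sum_congr rfl fun i _ => ?_
    have h := Complex.conj_mul' (y i)
    rw [starRingEnd_apply] at h
    rw [h]
    push_cast
    rfl
  have hU : (U : Matrix ι ι ℂ)ᴴ * (U : Matrix ι ι ℂ) = 1 :=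
    Matrix.UnitaryGroup.star_mul_self U
  have h2 : star ((U : Matrix ι ι ℂ) *ᵥ x) ⬝ᵥ ((U : Matrix ι ι ℂ) *ᵥ x) = star x ⬝ᵥ x := by
    rw [Matrix.star_mulVec, ← Matrix.dotProduct_mulVec, Matrix.mulVec_mulVec, hU,
      Matrix.one_mulVec]
  have h3 := (key ((U : Matrix ι ι ℂ) *ᵥ x)).trans (h2.trans (key x).symm)
  exact_mod_cast h3

/-- The state `U|ψ⟩`. -/
def apply [DecidableEq ι] (U : Matrix.unitaryGroup ι ℂ) (ψ : QState ι) : QState ι where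
  amp := (U : Matrix ι ι ℂ) *ᵥ ψ.amp
  norm_sq := (sum_norm_sq_mulVec U ψ.amp).trans ψ.norm_sq

/-- The state obtained by the permutation `|i⟩ ↦ |e i⟩` of the computational basis. -/
def permute (e : ι ≃ κ) (ψ : QState ι) : QState κ where
  amp := fun j => ψ.amp (e.symm j)
  norm_sq := (Equiv.sum_comp e.symm (fun i => ‖ψ.amp i‖ ^ 2)).trans ψ.norm_sq

/-- Born's rule: the law of the outcome of measuring every register of `ψ` in the computational
basis. -/
def measure (ψ : QState ι) : PMF ι :=
  PMF.ofFintype (fun i => ENNReal.ofReal (‖ψ.amp i‖ ^ 2)) (by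
    rw [← ENNReal.ofReal_sum_of_nonneg (fun i _ => by positivity), ψ.norm_sq, ENNReal.ofReal_one])

/-- The state `|x⟩ = ∑ⱼ xⱼ |j⟩` of a real unit vector. -/
def ofReal {n : ℕ} (x : EuclideanSpace ℝ (Fin n)) (hx : ‖x‖ = 1) : QState (Fin n) where
  amp := fun j => (x j : ℂ)
  norm_sq := by
    have h := EuclideanSpace.norm_sq_eq x
    rw [hx, one_pow] at h
    rw [h]
    simp

/-- The state `(|ψ₀⟩|0⟩ + |ψ₁⟩|1⟩)/√2`. -/
def flagged (ψ₀ ψ₁ : QState ι) : QState (ι × Fin 2) where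
  amp := fun p => ((if p.2 = 0 then ψ₀.amp p.1 else ψ₁.amp p.1) / (Real.sqrt 2 : ℂ))
  norm_sq := by
    have h2 : ‖(Real.sqrt 2 : ℂ)‖ ^ 2 = 2 := by
      rw [Complex.norm_real, Real.norm_eq_abs, sq_abs]
      exact Real.sq_sqrt (by norm_num)
    simp only [norm_div, div_pow, h2, Fintype.sum_prod_type, Fin.sum_univ_two]
    simp only [Finset.sum_add_distrib, ← Finset.sum_div, if_true, one_ne_zero, if_false,
      ψ₀.norm_sq, ψ₁.norm_sq]
    norm_num

end QState

/-- The Hadamard gate. -/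
def hadamard : Matrix.unitaryGroup (Fin 2) ℂ :=
  ⟨((1 / Real.sqrt 2 : ℝ) : ℂ) • !![1, 1; 1, -1], by
    have h : ((1 / Real.sqrt 2 : ℝ) : ℂ) * ((1 / Real.sqrt 2 : ℝ) : ℂ) = 1 / 2 := by
      rw [← Complex.ofReal_mul, div_mul_div_comm, Real.mul_self_sqrt (by norm_num)]
      norm_num
    rw [Matrix.mem_unitaryGroup_iff]
    ext i j
    fin_cases i <;> fin_cases j <;>
      simp [Matrix.mul_apply, Matrix.star_eq_conjTranspose, Fin.sum_univ_two] <;>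
      norm_num at h ⊢ <;> linear_combination 2 * h⟩

/-- The gate `U ⊗ V`. -/
def kron {ι κ : Type} [Fintype ι] [Fintype κ] [DecidableEq ι] [DecidableEq κ]
    (U : Matrix.unitaryGroup ι ℂ) (V : Matrix.unitaryGroup κ ℂ) :
    Matrix.unitaryGroup (ι × κ) ℂ :=
  ⟨(U : Matrix ι ι ℂ) ⊗ₖ (V : Matrix κ κ ℂ), Matrix.kronecker_mem_unitary U.2 V.2⟩

/-! ### The two overlap tests -/

/-- Controlled swap of the two middle registers, controlled by the first qubit. -/
def cswap (n : ℕ) (κ : Type) :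
    (Fin 2 × (Fin n × Fin n) × κ) ≃ (Fin 2 × (Fin n × Fin n) × κ) where
  toFun p := if p.1 = 1 then (p.1, p.2.1.swap, p.2.2) else p
  invFun p := if p.1 = 1 then (p.1, p.2.1.swap, p.2.2) else p
  left_inv p := by
    obtain ⟨c, ab, d⟩ := p
    by_cases h : c = 1 <;> simp [h]
  right_inv p := by
    obtain ⟨c, ab, d⟩ := p
    by_cases h : c = 1 <;> simp [h]

/-- The SWAP test on `|v⟩` and `|t⟩`: Hadamard, controlled swap, Hadamard, and measurement of the
control qubit. -/
def swapTest {n : ℕ} (v t : QState (Fin n)) : PMF (Fin 2) :=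
  let ψ₀ : QState (Fin 2 × (Fin n × Fin n) × Unit) :=
    (QState.basis 0).tensor ((v.tensor t).tensor (QState.basis ()))
  let ψ₁ := ψ₀.apply (kron hadamard 1)
  let ψ₂ := ψ₁.permute (cswap n Unit)
  let ψ₃ := ψ₂.apply (kron hadamard 1)
  ψ₃.measure.map fun p => p.1

/-- The variant of the SWAP test on `|v⟩` and a state `|φ⟩` with an additional qubit (used with
`|φ⟩ = (|t_k⟩|0⟩ + |t_i⟩|1⟩)/√2`): Hadamard on the control qubit, controlled swap of the registers
of dimension `n`, Hadamard on the control qubit and on the additional qubit, and measurement of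
these two qubits. -/
def signTest {n : ℕ} (v : QState (Fin n)) (φ : QState (Fin n × Fin 2)) : PMF (Fin 2 × Fin 2) :=
  let ψ₀ : QState (Fin 2 × (Fin n × Fin n) × Fin 2) :=
    (QState.basis 0).tensor ((v.tensor φ).permute (Equiv.prodAssoc (Fin n) (Fin n) (Fin 2)).symm)
  let ψ₁ := ψ₀.apply (kron hadamard 1)
  let ψ₂ := ψ₁.permute (cswap n (Fin 2))
  let ψ₃ := ψ₂.apply (kron hadamard (kron 1 hadamard))
  ψ₃.measure.map fun p => (p.1, p.2.2)

/-- The joint law of independent outcomes `o i ∼ p i`. -/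
def indep {ι α : Type} [Fintype ι] [Fintype α] (p : ι → PMF α) : PMF (ι → α) :=
  haveI := Classical.decEq ι
  PMF.ofFintype (fun f => ∏ i, p i (f i)) (by
    have h1 : ∀ i, ∑ a, p i a = 1 := fun i => by
      rw [← tsum_fintype (L := .unconditional _)]; exact (p i).tsum_coe
    have h := Finset.prod_univ_sum (fun _ : ι => (Finset.univ : Finset α)) (fun i a => p i a)
    rw [Fintype.piFinset_univ] at h
    rw [← h]
    simp [h1])

/-! ### The input matrix, its rows, and the row oracle -/

/-- The `i`-th row of `A`, as a Euclidean vector. -/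
def row {m n : ℕ} (A : Matrix (Fin m) (Fin n) ℝ) (i : Fin m) : EuclideanSpace ℝ (Fin n) :=
  WithLp.toLp 2 (A i)

/-- The normalized selected rows `s_i/‖s_i‖`, where `s_i = A_{g(i)}`. -/
def unitRow {m n r : ℕ} (A : Matrix (Fin m) (Fin n) ℝ) (g : Fin r → Fin m) (i : Fin r) :
    EuclideanSpace ℝ (Fin n) :=
  ‖row A (g i)‖⁻¹ • row A (g i)

/-- The Gram–Schmidt orthonormalization `t_1, …, t_r` of the normalized selected rows. -/
def orthoRow {m n r : ℕ} (A : Matrix (Fin m) (Fin n) ℝ) (g : Fin r → Fin m) (i : Fin r) :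
    EuclideanSpace ℝ (Fin n) :=
  InnerProductSpace.gramSchmidtNormed ℝ (unitRow A g) i

/-- The Gram matrix `C` of the normalized selected rows. -/
def gramC {m n r : ℕ} (A : Matrix (Fin m) (Fin n) ℝ) (g : Fin r → Fin m) :
    Matrix (Fin r) (Fin r) ℝ :=
  Matrix.gram ℝ (unitRow A g)

/-- The least singular value of a (nonempty) square matrix. -/
def sigmaMin {r : ℕ} (M : Matrix (Fin r) (Fin r) ℝ) : ℝ :=
  (Matrix.toEuclideanLin M).singularValues (r - 1)

/-- The transformation matrix `Z` with `(t_1, …, t_r) = (s_1/‖s_1‖, …, s_r/‖s_r‖) Z`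
(see `orthoRow_eq_sum`). -/
def transition {m n r : ℕ} (A : Matrix (Fin m) (Fin n) ℝ) (g : Fin r → Fin m) :
    Matrix (Fin r) (Fin r) ℝ :=
  (gramC A g)⁻¹ * Matrix.of fun i j => ⟪unitRow A g i, orthoRow A g j⟫_ℝ

theorem linearIndependent_unitRow {m n r : ℕ} {A : Matrix (Fin m) (Fin n) ℝ} {g : Fin r → Fin m}
    (h : LinearIndependent ℝ fun i => row A (g i)) : LinearIndependent ℝ (unitRow A g) := by
  have hne : ∀ i, ‖row A (g i)‖⁻¹ ≠ 0 := fun i => inv_ne_zero (norm_ne_zero_iff.2 (h.ne_zero i))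
  exact h.units_smul fun i => Units.mk0 _ (hne i)

theorem norm_orthoRow {m n r : ℕ} {A : Matrix (Fin m) (Fin n) ℝ} {g : Fin r → Fin m}
    (h : LinearIndependent ℝ fun i => row A (g i)) (i : Fin r) : ‖orthoRow A g i‖ = 1 :=
  InnerProductSpace.gramSchmidtNormed_unit_length i (linearIndependent_unitRow h)

/-- The orthonormal state `|t_i⟩`. -/
def orthoState {m n r : ℕ} (A : Matrix (Fin m) (Fin n) ℝ) (g : Fin r → Fin m)
    (h : LinearIndependent ℝ fun i => row A (g i)) (i : Fin r) : QState (Fin n) :=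
  QState.ofReal (orthoRow A g i) (norm_orthoRow h i)

theorem orthoRow_eq_sum {m n r : ℕ} {A : Matrix (Fin m) (Fin n) ℝ} {g : Fin r → Fin m}
    (h : LinearIndependent ℝ fun i => row A (g i)) (j : Fin r) :
    orthoRow A g j = ∑ i, transition A g i j • unitRow A g i := by
  have hmem : orthoRow A g j ∈ Submodule.span ℝ (Set.range (unitRow A g)) := by
    rw [← InnerProductSpace.span_gramSchmidt ℝ (unitRow A g),
      ← InnerProductSpace.span_gramSchmidtNormed_range]
    exact Submodule.subset_span ⟨j, rfl⟩
  obtain ⟨c, hc⟩ := (Submodule.mem_span_range_iff_exists_fun ℝ).1 hmem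
  have hdet : IsUnit (gramC A g).det :=
    (Matrix.det_gram_ne_zero_iff_linearIndependent.2 (linearIndependent_unitRow h)).isUnit
  have hinner : (fun i => ⟪unitRow A g i, orthoRow A g j⟫_ℝ) = gramC A g *ᵥ c := by
    funext i
    rw [← hc, inner_sum]
    simp only [Matrix.mulVec, dotProduct, gramC, Matrix.gram_apply, real_inner_smul_right]
    exact Finset.sum_congr rfl fun l _ => mul_comm _ _
  have hZ : ∀ i, transition A g i j = c i := by
    intro i
    have : transition A g i j
        = ((gramC A g)⁻¹ *ᵥ fun l => ⟪unitRow A g l, orthoRow A g j⟫_ℝ) i := by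
      simp [transition, Matrix.mul_apply, Matrix.mulVec, dotProduct]
    rw [this, hinner, Matrix.mulVec_mulVec, Matrix.nonsing_inv_mul _ hdet, Matrix.one_mulVec]
  simp only [hZ, hc]

/-- `U` is an oracle for the rows of `A`: `U|i⟩|0⟩ = |i⟩|A_i⟩` for every nonzero row `A_i`.
Nothing is assumed about `U` on the other basis states. -/
def IsRowOracle {m n : ℕ} [NeZero n] (A : Matrix (Fin m) (Fin n) ℝ)
    (U : Matrix.unitaryGroup (Fin m × Fin n) ℂ) : Prop :=
  ∀ i, row A i ≠ 0 → ∀ p : Fin m × Fin n,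
    (U : Matrix (Fin m × Fin n) (Fin m × Fin n) ℂ) p (i, 0) =
      if p.1 = i then ((A i p.2 / ‖row A i‖ : ℝ) : ℂ) else 0

/-! ### State preparation by circuits with oracle queries -/

/-- One gate of a query circuit on the two oracle registers, a flag qubit and a work register of
dimension `w + 1`: a unitary that does not involve the oracle, or one query to the oracle or to its
inverse. -/
inductive Gate (m n w : ℕ) : Type
  | free (V : Matrix.unitaryGroup ((Fin m × Fin n) × (Fin 2 × Fin (w + 1))) ℂ) : Gate m n w
  | query : Gate m n w
  | queryInv : Gate m n w

/-- The unitary carried out by a gate when the oracle is `U`. -/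
def Gate.unitary {m n w : ℕ} (U : Matrix.unitaryGroup (Fin m × Fin n) ℂ) :
    Gate m n w → Matrix.unitaryGroup ((Fin m × Fin n) × (Fin 2 × Fin (w + 1))) ℂ
  | .free V => V
  | .query => kron U 1
  | .queryInv => kron U⁻¹ 1

/-- The number of queries made by a gate. -/
def Gate.cost {m n w : ℕ} : Gate m n w → ℕ
  | .free _ => 0
  | .query => 1
  | .queryInv => 1

/-- A query circuit: a finite sequence of gates, applied from left to right. -/
structure Circuit (m n : ℕ) where
  w : ℕ
  gates : List (Gate m n w)

/-- The number of oracle queries of a circuit. -/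
def Circuit.queries {m n : ℕ} (c : Circuit m n) : ℕ :=
  (c.gates.map Gate.cost).sum

/-- The final state of a circuit that is run on `|0⟩|0⟩|0⟩|0⟩` with oracle `U`. -/
def Circuit.run {m n : ℕ} [NeZero m] [NeZero n] (c : Circuit m n)
    (U : Matrix.unitaryGroup (Fin m × Fin n) ℂ) :
    QState ((Fin m × Fin n) × (Fin 2 × Fin (c.w + 1))) :=
  c.gates.foldl (fun ψ G => ψ.apply (G.unitary U)) (QState.basis ((0, 0), (0, 0)))

/-- With oracle `U`, the circuit prepares `φ` in the second register and the flag qubit; the other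
registers return to `|0⟩`. -/
def Circuit.Prepares {m n : ℕ} [NeZero m] [NeZero n] (c : Circuit m n)
    (U : Matrix.unitaryGroup (Fin m × Fin n) ℂ) (φ : QState (Fin n × Fin 2)) : Prop :=
  ∀ (a : Fin m) (j : Fin n) (b : Fin 2) (e : Fin (c.w + 1)),
    (c.run U).amp ((a, j), (b, e)) = if a = 0 ∧ e = 0 then φ.amp (j, b) else 0

/-! ### The read-out algorithm -/

/-- An implementation of the read-out algorithm: the numbers of repetitions of the tests that
estimate one overlap in the first and in the second step, and the circuits that prepare `|t_i⟩`
and `(|t_k⟩|0⟩ + |t_i⟩|1⟩)/√2`. -/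
structure Implementation (m n r : ℕ) where
  shots₁ : ℕ
  shots₂ : ℕ
  prep₁ : Fin r → Circuit m n
  prep₂ : Fin r → Fin r → Circuit m n

namespace Implementation

variable {m n r : ℕ}

/-- With oracle `U`, all circuits prepare the states that the tests need. -/
def Correct [NeZero m] [NeZero n] (R : Implementation m n r)
    (U : Matrix.unitaryGroup (Fin m × Fin n) ℂ) (t : Fin r → QState (Fin n)) : Prop :=
  (∀ i, (R.prep₁ i).Prepares U ((t i).tensor (QState.basis 0))) ∧
    ∀ k i, (R.prep₂ k i).Prepares U ((t k).flagged (t i))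

/-- The number of copies of `|v⟩` used: one for each run of a test. -/
def copies (R : Implementation m n r) : ℕ :=
  r * R.shots₁ + r * R.shots₂

/-- The number of oracle queries used when the first step returns the index `k`: each run of a test
prepares its input state anew. -/
def queries (R : Implementation m n r) (k : Fin r) : ℕ :=
  ∑ i, R.shots₁ * (R.prep₁ i).queries + ∑ i, R.shots₂ * (R.prep₂ k i).queries

/-- The estimates of `|⟨v|t_i⟩|²`: the outcome `0` of the SWAP test has probability
`(1 + |⟨v|t_i⟩|²)/2`. -/
def estimate₁ (R : Implementation m n r) (o : Fin r × Fin R.shots₁ → Fin 2) (i : Fin r) : ℝ :=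
  2 * ((Finset.univ.filter fun s : Fin R.shots₁ => o (i, s) = 0).card / (R.shots₁ : ℝ)) - 1

/-- The estimates of `⟨t_k|v⟩⟨v|t_i⟩`: two equal outcomes of the variant test have probability
`(1 + ⟨t_k|v⟩⟨v|t_i⟩)/2`. -/
def estimate₂ (R : Implementation m n r) (o : Fin r × Fin R.shots₂ → Fin 2 × Fin 2)
    (i : Fin r) : ℝ :=
  2 * ((Finset.univ.filter fun s : Fin R.shots₂ => (o (i, s)).1 = (o (i, s)).2).card /
    (R.shots₂ : ℝ)) - 1

end Implementation

/-- An index at which `f` is maximal. -/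
def argmax {r : ℕ} [NeZero r] (f : Fin r → ℝ) : Fin r :=
  (Finite.exists_max f).choose

/-- `a / ‖a‖`, with the Euclidean norm. -/
def normalize {r : ℕ} (a : Fin r → ℝ) : Fin r → ℝ :=
  fun i => a i / Real.sqrt (∑ j, a j ^ 2)

/-- The read-out algorithm on the state `|v⟩` and the orthonormal states `|t_i⟩`. It returns the
index `k` found in the first step and the coordinates `x`:
1. estimate all `|⟨v|t_i⟩|²` by the SWAP test, and let `k` be an index with the largest estimate;
2. estimate all `⟨t_k|v⟩⟨v|t_i⟩` by the variant test, and normalize the vector of estimates to `a`;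
3. return `x = Z a`. -/
def readout {m n r : ℕ} [NeZero r] (R : Implementation m n r) (Z : Matrix (Fin r) (Fin r) ℝ)
    (t : Fin r → QState (Fin n)) (v : QState (Fin n)) : PMF (Fin r × (Fin r → ℝ)) :=
  (indep fun p : Fin r × Fin R.shots₁ => swapTest v (t p.1)).bind fun o₁ =>
    let k := argmax (R.estimate₁ o₁)
    (indep fun p : Fin r × Fin R.shots₂ => signTest v ((t k).flagged (t p.1))).map fun o₂ =>
      (k, Z *ᵥ normalize (R.estimate₂ o₂))

end QReadout

end

noncomputable section

namespace QReadout

/-! ### Acceptance probabilities of the two tests -/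

/-! Write `α i = ⟪t_i, v⟫`. Since `A` has rank `r`, the `t_i` form an orthonormal basis of the row
space (`eq_sum_orthoRow`), so `∑ α_i² = 1` and the output error is the Euclidean distance of the
normalized estimates from `± α`. The tests accept with probabilities `(1 + α_i²)/2` and `(1 + α_k
α_i)/2` (`swapTest_zero`, `signTest_equal`), so all estimates are rescaled binomial counts.

State preparation (`exists_circuit_prepares`). One query turns a superposition of row indices into
`∑ c_i |g(i)⟩|s_i⟩`; projecting the index register on the uniform superposition of the `g(i)` leaves
the wanted state with amplitude `l/√r`. This amplitude is known in advance from `Z`, because the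
target has known norm. An ancilla lowers it to the sine of an angle `θ` with `(2k+1)θ = π/2`, so `k`
Grover iterations reach the target exactly, with `O(√r / l)` queries. Columns of `Z` have norm at
most `σ_min(C)^(-1/2)`, which bounds `1/l`.

First step. It suffices to find `k` with `α_k² ≥ 1/(4r)`. A union bound over estimates of accuracy
`1/r` would need more than `O(r²)` shots per index. Instead `exists_threshold` takes the least count
`s` that a fixed bad index exceeds only with probability `O(δ/r)`. Bad indices then all stay below
`s` with high probability. Some good index reaches `s`: either one overlap is so large that
Chebyshev suffices, or all overlaps are moderate, and then a likelihood ratio estimate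
(`mul_binomTail_le`) shows that a good index reaches `s` more often than a bad one by a factor
proportional to its overlap. As the overlaps sum to `1`, the expected number of good indices that
reach `s` is at least of order `1/δ`, and independence makes it unlikely that none does.

Second step. The expected total square error of `N₂` shots per index is at most `r/N₂`, so Markov's
inequality applied to the sum costs no logarithm. Normalization divides by `|α_k| ≥ 1/(2√r)`
(`sum_sq_normalize_sub_le`), so `N₂ = O(r²/(δε²))` is enough. -/

theorem QState.apply_kron_amp {ι κ : Type} [Fintype ι] [Fintype κ] [DecidableEq ι] [DecidableEq κ]
    (U : Matrix.unitaryGroup ι ℂ) (V : Matrix.unitaryGroup κ ℂ) (ψ : QState (ι × κ)) (p : ι × κ) :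
    (ψ.apply (kron U V)).amp p = ∑ a, ∑ b, (U : Matrix ι ι ℂ) p.1 a *
      ((V : Matrix κ κ ℂ) p.2 b * ψ.amp (a, b)) := by
  simp only [QState.apply, kron, Matrix.mulVec, dotProduct, Fintype.sum_prod_type,
    Matrix.kroneckerMap_apply, mul_assoc]

theorem QState.apply_kron_one_amp {ι κ : Type} [Fintype ι] [Fintype κ] [DecidableEq ι]
    [DecidableEq κ] (U : Matrix.unitaryGroup ι ℂ) (ψ : QState (ι × κ)) (p : ι × κ) :
    (ψ.apply (kron U 1)).amp p = ∑ a, (U : Matrix ι ι ℂ) p.1 a * ψ.amp (a, p.2) := by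
  rw [QState.apply_kron_amp]
  refine Finset.sum_congr rfl fun a _ => ?_
  simp [Matrix.one_apply]

theorem QState.apply_kron_kron_amp {ι κ μ : Type} [Fintype ι] [Fintype κ] [Fintype μ]
    [DecidableEq ι] [DecidableEq κ] [DecidableEq μ] (U : Matrix.unitaryGroup ι ℂ)
    (V : Matrix.unitaryGroup μ ℂ) (ψ : QState (ι × κ × μ)) (p : ι × κ × μ) :
    (ψ.apply (kron U (kron 1 V))).amp p = ∑ a, ∑ d, (U : Matrix ι ι ℂ) p.1 a *
      ((V : Matrix μ μ ℂ) p.2.2 d * ψ.amp (a, (p.2.1, d))) := by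
  rw [QState.apply_kron_amp]
  refine Finset.sum_congr rfl fun a _ => ?_
  rw [Fintype.sum_prod_type, Finset.sum_comm]
  refine Finset.sum_congr rfl fun d _ => ?_
  rw [Finset.sum_eq_single p.2.1]
  · simp [kron]
  · intro b _ hb
    have : (1 : Matrix κ κ ℂ) p.2.1 b = 0 := Matrix.one_apply_ne hb.symm
    simp [kron, this]
  · simp

theorem QState.toReal_measure_apply {ι : Type} [Fintype ι] (ψ : QState ι) (i : ι) :
    (ψ.measure i).toReal = ‖ψ.amp i‖ ^ 2 := by
  simp [QState.measure]

theorem toReal_map_apply {α β : Type} [Fintype α] [DecidableEq β] (p : PMF α) (f : α → β) (b : β) :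
    ((p.map f) b).toReal = ∑ a, if b = f a then (p a).toReal else 0 := by
  rw [PMF.map_apply, tsum_fintype, ENNReal.toReal_sum]
  · refine Finset.sum_congr rfl fun a _ => ?_
    split_ifs <;> simp_all
  · intro a _
    split_ifs <;> simp [p.apply_ne_top]

theorem hadamard_apply (i j : Fin 2) :
    (hadamard : Matrix (Fin 2) (Fin 2) ℂ) i j =
      ((Real.sqrt 2 : ℝ) : ℂ)⁻¹ * (if i = 1 ∧ j = 1 then -1 else 1) := by
  fin_cases i <;> fin_cases j <;> simp [hadamard]

/-- This is the squared norm of the (anti)symmetrized product `c (x ⊗ y + σ y ⊗ x)`, the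
unnormalized state that remains after the control qubit is measured. The vector `y` need not be a
unit vector: in the second test it is `t ± t'`. -/
theorem norm_sq_ofReal_add {n : ℕ} (c : ℝ) (x y : Fin n → ℝ) (σ : ℝ) (hσ : σ ^ 2 = 1) :
    ∑ a, ∑ b, (c * (x a * y b + σ * (x b * y a))) ^ 2 =
      2 * c ^ 2 * ((∑ a, x a ^ 2) * (∑ b, y b ^ 2) + σ * (∑ a, x a * y a) ^ 2) := by
  have h1 : ∑ a, ∑ b, x a ^ 2 * y b ^ 2 = (∑ a, x a ^ 2) * (∑ b, y b ^ 2) := by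
    rw [Finset.sum_mul_sum]
  have h2 : ∑ a, ∑ b, x b ^ 2 * y a ^ 2 = (∑ a, x a ^ 2) * (∑ b, y b ^ 2) := by
    rw [Finset.sum_comm, h1]
  have h3 : ∑ a, ∑ b, (x a * y a) * (x b * y b) = (∑ a, x a * y a) ^ 2 := by
    rw [sq, Finset.sum_mul_sum]
  have : ∀ a b, (c * (x a * y b + σ * (x b * y a))) ^ 2 =
      c ^ 2 * (x a ^ 2 * y b ^ 2) + c ^ 2 * (x b ^ 2 * y a ^ 2) +
        2 * c ^ 2 * σ * ((x a * y a) * (x b * y b)) := by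
    intro a b
    linear_combination (c ^ 2 * (x b * y a) ^ 2) * hσ
  have hc : ∀ (k : ℝ) (f : Fin n → Fin n → ℝ), ∑ a, ∑ b, k * f a b = k * ∑ a, ∑ b, f a b := by
    intro k f
    simp only [Finset.mul_sum]
  simp only [this, Finset.sum_add_distrib]
  rw [hc, hc, hc, h1, h2, h3]
  ring

/-- Outcome `0` of the control qubit leaves the symmetric part `(v ⊗ t + t ⊗ v)/2`, whose squared
norm is the probability. -/
theorem swapTest_zero {n : ℕ} (v t : EuclideanSpace ℝ (Fin n)) (hv : ‖v‖ = 1) (ht : ‖t‖ = 1) :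
    (swapTest (QState.ofReal v hv) (QState.ofReal t ht) 0).toReal = (1 + ⟪t, v⟫_ℝ ^ 2) / 2 := by
  have hs : ((Real.sqrt 2 : ℝ) : ℂ)⁻¹ * ((Real.sqrt 2 : ℝ) : ℂ)⁻¹ = 1 / 2 := by
    rw [← mul_inv, ← Complex.ofReal_mul, Real.mul_self_sqrt (by norm_num)]; norm_num
  have key : ∀ (p : Fin 2 × (Fin n × Fin n) × Unit), p.1 = 0 →
      (((((QState.basis 0).tensor (((QState.ofReal v hv).tensor
        (QState.ofReal t ht)).tensor (QState.basis ()))).apply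
        (kron hadamard 1)).permute (cswap n Unit)).apply (kron hadamard 1)).amp p =
      (((1 / 2 : ℝ) * (v p.2.1.1 * t p.2.1.2 + 1 * (v p.2.1.2 * t p.2.1.1)) : ℝ) : ℂ) := by
    rintro ⟨c, ⟨a, b⟩, u⟩ rfl
    rw [QState.apply_kron_one_amp]
    simp [QState.permute, QState.apply_kron_one_amp, cswap, hadamard, QState.tensor, QState.basis,
      QState.ofReal]
    linear_combination (v a * t b + v b * t a : ℂ) * hs
  rw [swapTest, toReal_map_apply]
  simp only [QState.toReal_measure_apply]
  trans ∑ p : Fin 2 × (Fin n × Fin n) × Unit, if (0 : Fin 2) = p.1 then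
    ((1 / 2 : ℝ) * (v p.2.1.1 * t p.2.1.2 + 1 * (v p.2.1.2 * t p.2.1.1))) ^ 2 else 0
  · refine Finset.sum_congr rfl fun p _ => ?_
    split_ifs with h
    · rw [key p h.symm, Complex.norm_real, Real.norm_eq_abs, sq_abs]
    · rfl
  simp only [Fintype.sum_prod_type, Fin.sum_univ_two, if_true, zero_ne_one,
    if_false, Finset.sum_const_zero, add_zero, Finset.univ_unique, Finset.sum_singleton]
  rw [norm_sq_ofReal_add _ _ _ _ (by norm_num)]
  have e1 := EuclideanSpace.real_norm_sq_eq v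
  have e2 := EuclideanSpace.real_norm_sq_eq t
  rw [← e1, ← e2, hv, ht]
  simp [PiLp.inner_apply]
  ring

/-- The last Hadamard gate turns the flagged pair into `t + σ t'` up to scale, and the control
outcome symmetrizes with the same sign `σ`. The four factors `1/√2` (three Hadamard gates and the
flagged state) give amplitude `1/4`. -/
theorem signTest_diag {n : ℕ} (v t t' : EuclideanSpace ℝ (Fin n)) (hv : ‖v‖ = 1) (ht : ‖t‖ = 1)
    (ht' : ‖t'‖ = 1) (c : Fin 2) :
    (signTest (QState.ofReal v hv) ((QState.ofReal t ht).flagged (QState.ofReal t' ht'))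
      (c, c)).toReal = 1 / 8 * ((∑ b, (t b + (-1) ^ (c : ℕ) * t' b) ^ 2) + (-1) ^ (c : ℕ) *
        (⟪t, v⟫_ℝ + (-1) ^ (c : ℕ) * ⟪t', v⟫_ℝ) ^ 2) := by
  set σ : ℝ := (-1) ^ (c : ℕ) with hσ
  have hs : ((Real.sqrt 2 : ℝ) : ℂ)⁻¹ ^ 2 = 1 / 2 := by
    rw [inv_pow, ← Complex.ofReal_pow, Real.sq_sqrt (by norm_num)]; norm_num
  have hs4 : ((Real.sqrt 2 : ℝ) : ℂ)⁻¹ ^ 4 = 1 / 4 := by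
    rw [show (4 : ℕ) = 2 * 2 by norm_num, pow_mul, hs]; norm_num
  have key : ∀ (p : Fin 2 × (Fin n × Fin n) × Fin 2), p.1 = c → p.2.2 = c →
      (((((QState.basis 0).tensor (((QState.ofReal v hv).tensor
        ((QState.ofReal t ht).flagged (QState.ofReal t' ht'))).permute
          (Equiv.prodAssoc (Fin n) (Fin n) (Fin 2)).symm)).apply
        (kron hadamard 1)).permute (cswap n (Fin 2))).apply
          (kron hadamard (kron 1 hadamard))).amp p =
      (((1 / 4 : ℝ) * (v p.2.1.1 * (t p.2.1.2 + σ * t' p.2.1.2) +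
        σ * (v p.2.1.2 * (t p.2.1.1 + σ * t' p.2.1.1))) : ℝ) : ℂ) := by
    rintro ⟨c', ⟨a, b⟩, u⟩ h1 h2
    simp only at h1 h2
    rw [QState.apply_kron_kron_amp, h1, h2]
    clear_value σ
    subst hσ
    fin_cases c <;>
    · simp [QState.permute, QState.apply_kron_one_amp, cswap, QState.tensor, QState.basis,
        QState.ofReal, QState.flagged, hadamard_apply, -mul_eq_mul_left_iff, div_eq_mul_inv]
      ring_nf
      simp only [hs4]
      ring
  rw [signTest, toReal_map_apply]
  simp only [QState.toReal_measure_apply]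
  trans ∑ p : Fin 2 × (Fin n × Fin n) × Fin 2, if c = p.1 then if c = p.2.2 then
    ((1 / 4 : ℝ) * (v p.2.1.1 * (t p.2.1.2 + σ * t' p.2.1.2) +
      σ * (v p.2.1.2 * (t p.2.1.1 + σ * t' p.2.1.1)))) ^ 2 else 0 else 0
  · refine Finset.sum_congr rfl fun p _ => ?_
    simp only [Prod.mk.injEq, ite_and]
    split_ifs with h h'
    · rw [key p h.symm h'.symm, Complex.norm_real, Real.norm_eq_abs, sq_abs]
    · rfl
    · rfl
  simp only [Fintype.sum_prod_type, Finset.sum_ite_irrel, Finset.sum_const_zero, Finset.sum_ite_eq,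
    Finset.mem_univ, if_true]
  have hσ2 : σ ^ 2 = 1 := by rw [hσ, ← pow_mul, mul_comm, pow_mul]; norm_num
  rw [norm_sq_ofReal_add (1 / 4) v (fun b => t b + σ * t' b) σ hσ2]
  have e1 := EuclideanSpace.real_norm_sq_eq v
  rw [← e1, hv]
  have e3 : ∑ a, v a * (t a + σ * t' a) = ⟪t, v⟫_ℝ + σ * ⟪t', v⟫_ℝ := by
    simp only [PiLp.inner_apply, Finset.mul_sum, ← Finset.sum_add_distrib]
    exact Finset.sum_congr rfl fun a _ => by simp; ring
  rw [e3]
  ring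

/-- Summing over `σ = ±1`, the terms `2σ⟪t, t'⟫` cancel and `(a + b)² - (a - b)² = 4ab`.
Orthogonality of `t` and `t'` plays no role, so the case `i = k` is included. -/
theorem signTest_equal {n : ℕ} (v t t' : EuclideanSpace ℝ (Fin n)) (hv : ‖v‖ = 1) (ht : ‖t‖ = 1)
    (ht' : ‖t'‖ = 1) :
    ∑ x : Fin 2 × Fin 2, (if x.1 = x.2 then (signTest (QState.ofReal v hv)
      ((QState.ofReal t ht).flagged (QState.ofReal t' ht')) x).toReal else 0) =
      (1 + ⟪t, v⟫_ℝ * ⟪t', v⟫_ℝ) / 2 := by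
  have e1 : ∑ b, t b ^ 2 = 1 := by rw [← EuclideanSpace.real_norm_sq_eq, ht]; norm_num
  have e2 : ∑ b, t' b ^ 2 = 1 := by rw [← EuclideanSpace.real_norm_sq_eq, ht']; norm_num
  have e3 : ∀ σ : ℝ, σ ^ 2 = 1 → ∑ b, (t b + σ * t' b) ^ 2 = 2 + 2 * σ * ∑ b, t b * t' b := by
    intro σ hσ
    have : ∀ b, (t b + σ * t' b) ^ 2 = t b ^ 2 + t' b ^ 2 + 2 * σ * (t b * t' b) := by
      intro b; linear_combination (t' b ^ 2) * hσ
    simp only [this, Finset.sum_add_distrib, e1, e2, Finset.mul_sum]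
    norm_num
  simp only [Fintype.sum_prod_type, Fin.sum_univ_two, if_true, zero_ne_one, one_ne_zero, if_false]
  rw [signTest_diag, signTest_diag, e3 _ (by norm_num), e3 _ (by norm_num)]
  simp
  ring

/-! ### Reflections -/

section Reflections

variable {ι : Type} [Fintype ι]

/-- The unitary `1 - 2P` for an orthogonal projection `P`. -/
theorem exists_unitary_one_sub [DecidableEq ι] (P : Matrix ι ι ℂ) (hP : Pᴴ = P) (hPP : P * P = P) :
    ∃ V : Matrix.unitaryGroup ι ℂ, ∀ x, (V : Matrix ι ι ℂ) *ᵥ x = x - (2 : ℂ) • (P *ᵥ x) := by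
  refine ⟨⟨1 - (2 : ℂ) • P, ?_⟩, fun x => ?_⟩
  · rw [Matrix.mem_unitaryGroup_iff, Matrix.star_eq_conjTranspose]
    have : (1 - (2 : ℂ) • P)ᴴ = 1 - (2 : ℂ) • P := by
      rw [Matrix.conjTranspose_sub, Matrix.conjTranspose_one, Matrix.conjTranspose_smul, hP]
      simp
    simp only [this, sub_mul, mul_sub, Matrix.smul_mul, Matrix.mul_smul, hPP, one_mul, mul_one]
    module
  · simp [Matrix.sub_mulVec, Matrix.smul_mulVec]

theorem exists_unitary_sub_one [DecidableEq ι] (P : Matrix ι ι ℂ) (hP : Pᴴ = P) (hPP : P * P = P) :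
    ∃ V : Matrix.unitaryGroup ι ℂ, ∀ x, (V : Matrix ι ι ℂ) *ᵥ x = (2 : ℂ) • (P *ᵥ x) - x := by
  obtain ⟨V, hV⟩ := exists_unitary_one_sub P hP hPP
  refine ⟨⟨-V, ?_⟩, fun x => ?_⟩
  · have := V.2
    rw [Matrix.mem_unitaryGroup_iff] at this ⊢
    simpa only [star_neg, neg_mul_neg] using this
  · rw [Matrix.neg_mulVec, hV]
    module

/-- The reflection `x ↦ 2 ⟨χ, x⟩ χ - x`. -/
theorem exists_unitary_reflection [DecidableEq ι] (χ : ι → ℂ) (hχ : star χ ⬝ᵥ χ = 1) :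
    ∃ V : Matrix.unitaryGroup ι ℂ,
      ∀ x, (V : Matrix ι ι ℂ) *ᵥ x = (2 * (star χ ⬝ᵥ x)) • χ - x := by
  obtain ⟨V, hV⟩ := exists_unitary_sub_one (Matrix.vecMulVec χ (star χ))
    (by rw [Matrix.conjTranspose_vecMulVec, star_star])
    (by rw [Matrix.vecMulVec_mul_vecMulVec, hχ, one_smul])
  refine ⟨V, fun x => ?_⟩
  rw [hV, Matrix.vecMulVec_mulVec]
  ext i
  simp
  ring

/-- Some unitary maps `x` to `y`, for unit vectors whose inner product is real. -/
theorem exists_unitary_mulVec_eq [DecidableEq ι] (x y : ι → ℂ)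
    (hx : star x ⬝ᵥ x = 1) (hy : star y ⬝ᵥ y = 1)
    (hxy : star x ⬝ᵥ y = star y ⬝ᵥ x) :
    ∃ V : Matrix.unitaryGroup ι ℂ, (V : Matrix ι ι ℂ) *ᵥ x = y := by
  by_cases h : x = y
  · exact ⟨1, by simp [h]⟩
  -- Householder reflection in the hyperplane orthogonal to `x - y`. It sends `x` to `y` because
  -- `⟨w, x⟩` is half of `⟨w, w⟩`, which needs `⟨x, y⟩` to be real.
  set w := x - y with hw
  set N := star w ⬝ᵥ w with hN
  have hN0 : N ≠ 0 := by
    intro h0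
    open scoped ComplexOrder in
    exact h (sub_eq_zero.1 (dotProduct_star_self_eq_zero.1 h0))
  have hNx : N = 2 * (star w ⬝ᵥ x) := by
    simp only [hN, hw, star_sub, sub_dotProduct, dotProduct_sub, hx, hy, hxy]
    ring
  have hNs : star N = N := by
    rw [hN]
    exact (Matrix.star_dotProduct w w).symm
  obtain ⟨V, hV⟩ := exists_unitary_one_sub (N⁻¹ • Matrix.vecMulVec w (star w))
    (by rw [Matrix.conjTranspose_smul, Matrix.conjTranspose_vecMulVec, star_star, star_inv₀, hNs])
    (by rw [Matrix.smul_mul, Matrix.mul_smul, Matrix.vecMulVec_mul_vecMulVec, ← hN,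
          Matrix.vecMulVec_smul, smul_smul, smul_smul, mul_assoc, inv_mul_cancel₀ hN0, mul_one])
  refine ⟨V, ?_⟩
  rw [hV, Matrix.smul_mulVec, Matrix.vecMulVec_mulVec]
  have hwx : star w ⬝ᵥ x = N / 2 := by rw [hNx]; ring
  rw [hwx]
  ext i
  simp only [Pi.sub_apply, Pi.smul_apply, smul_eq_mul, MulOpposite.smul_eq_mul_unop,
    MulOpposite.unop_op]
  have : N⁻¹ * (w i * (N / 2)) = w i / 2 := by field_simp
  rw [this, hw]
  simp
  ring


/-- Powers of the Grover iterate `y ↦ 2 ⟨ψ, y⟩ ψ - y`, `y = x - 2 P x`, applied to `ψ`. -/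
theorem grover_iterate (P : Matrix ι ι ℂ) (hP : Pᴴ = P) (ψ G : ι → ℂ) (θ : ℝ)
    (hθ : Real.cos θ ≠ 0) (hψ : star ψ ⬝ᵥ ψ = 1) (hG : star G ⬝ᵥ G = 1)
    (hPψ : P *ᵥ ψ = (Real.sin θ : ℂ) • G) (hPG : P *ᵥ G = G) (Q : (ι → ℂ) → ι → ℂ)
    (hQ : ∀ x, Q x = (2 * (star ψ ⬝ᵥ (x - (2 : ℂ) • (P *ᵥ x)))) • ψ - (x - (2 : ℂ) • (P *ᵥ x)))
    (k : ℕ) :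
    -- The iterate is a product of two reflections that preserve the plane of `G` and `ψ - sin θ G`,
    -- hence a rotation by `2θ`, and `ψ` starts at angle `θ`. The second vector has norm `|cos θ|`,
    -- hence the division.
    Q^[k] ψ = (Real.sin ((2 * k + 1) * θ) : ℂ) • G +
      ((Real.cos ((2 * k + 1) * θ) / Real.cos θ : ℝ) : ℂ) • (ψ - (Real.sin θ : ℂ) • G) := by
  have hψG : star ψ ⬝ᵥ G = Real.sin θ := by
    conv_lhs => rw [← hPG]
    rw [Matrix.dotProduct_mulVec, ← hP, ← Matrix.star_mulVec, hPψ, star_smul,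
      smul_dotProduct, hG, smul_eq_mul, mul_one]
    exact Complex.conj_ofReal _
  have hc : (Real.cos θ : ℂ) ≠ 0 := by exact_mod_cast hθ
  have hsc : (Real.sin θ : ℂ) ^ 2 + (Real.cos θ : ℂ) ^ 2 = 1 := by
    exact_mod_cast Real.sin_sq_add_cos_sq θ
  induction k with
  | zero =>
    simp [div_self hθ]
  | succ k ih =>
    rw [Function.iterate_succ_apply', ih, hQ]
    have e : (2 * ((k + 1 : ℕ) : ℝ) + 1) * θ = (2 * k + 1) * θ + 2 * θ := by push_cast; ring
    rw [e, Real.sin_add, Real.cos_add, Real.sin_two_mul, Real.cos_two_mul]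
    set a := Real.sin ((2 * k + 1) * θ)
    set b := Real.cos ((2 * k + 1) * θ)
    set s := Real.sin θ
    set c := Real.cos θ
    simp only [Matrix.mulVec_add, Matrix.mulVec_sub, Matrix.mulVec_smul, hPψ, hPG, dotProduct_add,
      dotProduct_sub, dotProduct_smul, hψ, hψG, sub_self, smul_zero, add_zero, smul_eq_mul]
    ext i
    simp only [Pi.sub_apply, Pi.add_apply, Pi.smul_apply, smul_eq_mul]
    push_cast
    field_simp
    have h1 : (s : ℂ) ^ 2 = 1 - (c : ℂ) ^ 2 := by linear_combination hsc
    ring_nf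
    simp only [h1]
    ring

end Reflections

/-! ### Exact preparation of combinations of rows -/

/-- The amplitudes after a sequence of gates. -/
theorem foldl_apply_amp {m n w : ℕ} (U : Matrix.unitaryGroup (Fin m × Fin n) ℂ)
    (l : List (Gate m n w)) (ψ : QState ((Fin m × Fin n) × (Fin 2 × Fin (w + 1)))) :
    (l.foldl (fun ψ G => ψ.apply (G.unitary U)) ψ).amp =
      l.foldl (fun x G => (G.unitary U : Matrix _ _ ℂ) *ᵥ x) ψ.amp := by
  induction l generalizing ψ with
  | nil => rfl
  | cons G l ih => rw [List.foldl_cons, List.foldl_cons, ih]; rfl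

theorem foldl_flatten_replicate {α β : Type} (f : β → α → β) (l : List α) (k : ℕ) (b : β) :
    (List.replicate k l).flatten.foldl f b = (fun b => l.foldl f b)^[k] b := by
  induction k generalizing b with
  | zero => rfl
  | succ k ih => rw [List.replicate_succ, List.flatten_cons, List.foldl_append, ih]; rfl

/-- Extension of a family along an injection by `0`. -/
def extendZero {m r : ℕ} (g : Fin r → Fin m) (f : Fin r → ℝ) (a : Fin m) : ℝ :=
  ∑ i, if a = g i then f i else 0

theorem sum_mul_extendZero {m r : ℕ} (g : Fin r → Fin m) (f : Fin r → ℝ) (h : Fin m → ℂ) :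
    ∑ a, h a * (extendZero g f a : ℂ) = ∑ i, h (g i) * f i := by
  simp only [extendZero, Complex.ofReal_sum, Finset.mul_sum]
  rw [Finset.sum_comm]
  refine Finset.sum_congr rfl fun i _ => ?_
  rw [Finset.sum_eq_single (g i)] <;> simp +contextual

theorem extendZero_apply {m r : ℕ} {g : Fin r → Fin m} (hg : Function.Injective g)
    (f : Fin r → ℝ) (i : Fin r) : extendZero g f (g i) = f i := by
  rw [extendZero, Finset.sum_eq_single i]
  · simp
  · intro j _ hj
    rw [if_neg fun h => hj (hg h).symm]
  · simp

/-- The projection on `|u⟩` in the first register and on `|0⟩` in the work register. -/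
def goodProj {m : ℕ} (n : ℕ) (u : Fin m → ℝ) :
    Matrix ((Fin m × Fin n) × (Fin 2 × Fin 2)) ((Fin m × Fin n) × (Fin 2 × Fin 2)) ℂ :=
  (Matrix.vecMulVec (fun a => (u a : ℂ)) (star fun a => (u a : ℂ)) ⊗ₖ
    (1 : Matrix (Fin n) (Fin n) ℂ))
    ⊗ₖ ((1 : Matrix (Fin 2) (Fin 2) ℂ) ⊗ₖ Matrix.single 0 0 1)

theorem conjTranspose_goodProj {m : ℕ} (n : ℕ) (u : Fin m → ℝ) :
    (goodProj n u)ᴴ = goodProj n u := by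
  simp only [goodProj, Matrix.conjTranspose_kronecker, Matrix.conjTranspose_one,
    Matrix.conjTranspose_vecMulVec, star_star, Matrix.conjTranspose_single, star_one]

theorem goodProj_mul_self {m : ℕ} (n : ℕ) (u : Fin m → ℝ) (hu : ∑ a, (u a : ℂ) * u a = 1) :
    goodProj n u * goodProj n u = goodProj n u := by
  have : star (fun a => (u a : ℂ)) ⬝ᵥ (fun a => (u a : ℂ)) = 1 := by
    simpa [dotProduct] using hu
  simp only [goodProj, ← Matrix.mul_kronecker_mul, Matrix.vecMulVec_mul_vecMulVec, this, one_smul,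
    mul_one, Matrix.single_mul_single_same]

theorem goodProj_mulVec {m n : ℕ} (u : Fin m → ℝ)
    (x : (Fin m × Fin n) × (Fin 2 × Fin 2) → ℂ) (a : Fin m) (j : Fin n) (b e : Fin 2) :
    (goodProj n u *ᵥ x) ((a, j), (b, e)) =
      if e = 0 then u a * ∑ a', u a' * x ((a', j), (b, 0)) else 0 := by
  simp only [goodProj, Matrix.mulVec, dotProduct, Fintype.sum_prod_type,
    Matrix.kroneckerMap_apply, Matrix.vecMulVec_apply, Matrix.one_apply, Matrix.single_apply]
  by_cases he : e = 0
  · subst he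
    simp [Finset.mul_sum, mul_assoc, ite_mul]
  · simp [he, Ne.symm he]

theorem QState.star_amp_dotProduct {ι : Type} [Fintype ι] (φ : QState ι) :
    star φ.amp ⬝ᵥ φ.amp = 1 := by
  have h := φ.norm_sq
  have : star φ.amp ⬝ᵥ φ.amp = ((∑ i, ‖φ.amp i‖ ^ 2 : ℝ) : ℂ) := by
    simp only [dotProduct, Pi.star_apply, Complex.ofReal_sum]
    refine Finset.sum_congr rfl fun i _ => ?_
    rw [← starRingEnd_apply, Complex.conj_mul']
    push_cast
    rfl
  rw [this, h, Complex.ofReal_one]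

theorem coe_inv_mulVec_coe_mulVec {ι : Type} [Fintype ι] [DecidableEq ι]
    (W : Matrix.unitaryGroup ι ℂ) (x : ι → ℂ) :
    (W : Matrix ι ι ℂ) *ᵥ ((W⁻¹ : Matrix.unitaryGroup ι ℂ) : Matrix ι ι ℂ) *ᵥ x = x := by
  rw [Matrix.mulVec_mulVec, ← Matrix.UnitaryGroup.mul_val, mul_inv_cancel]
  simp

theorem kron_inv_one {ι κ : Type} [Fintype ι] [Fintype κ] [DecidableEq ι] [DecidableEq κ]
    (U : Matrix.unitaryGroup ι ℂ) :
    (kron U⁻¹ (1 : Matrix.unitaryGroup κ ℂ)) = (kron U (1 : Matrix.unitaryGroup κ ℂ))⁻¹ := by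
  apply Subtype.ext
  rw [Matrix.UnitaryGroup.inv_val, Matrix.star_eq_conjTranspose]
  simp only [kron, Matrix.conjTranspose_kronecker, Matrix.UnitaryGroup.inv_val,
    Matrix.star_eq_conjTranspose]
  simp

/-- Take `k = ⌈x⌉` and `θ = π/(2(2k+1))`; then `sin θ ≤ θ ≤ 2/(2k+1)` by `π ≤ 4`. The last bound
says that the ancilla amplitude `sin θ · x` is admissible. -/
theorem exists_amplification_angle (x : ℝ) (hx : 0 < x) :
    ∃ k : ℕ, ∃ θ : ℝ, (k : ℝ) ≤ x + 1 ∧ (2 * k + 1) * θ = Real.pi / 2 ∧ Real.cos θ ≠ 0 ∧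
      0 ≤ Real.sin θ ∧ Real.sin θ * x ≤ 1 := by
  have hk : x ≤ ⌈x⌉₊ := Nat.le_ceil x
  set k := ⌈x⌉₊ with hkdef
  have hk1 : (1 : ℝ) ≤ k := by
    exact_mod_cast Nat.ceil_pos.2 hx
  have hpi := Real.pi_pos
  have hpi4 := Real.pi_le_four
  have hθ : Real.pi / 2 / (2 * k + 1) < Real.pi / 2 :=
    div_lt_self (by positivity) (by linarith)
  have hθ0 : 0 ≤ Real.pi / 2 / (2 * k + 1) := by positivity
  refine ⟨k, Real.pi / 2 / (2 * k + 1), (Nat.ceil_lt_add_one hx.le).le, by field_simp, ?_, ?_, ?_⟩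
  · exact (Real.cos_pos_of_mem_Ioo ⟨by linarith, hθ⟩).ne'
  · exact Real.sin_nonneg_of_nonneg_of_le_pi hθ0 (by linarith)
  · calc Real.sin (Real.pi / 2 / (2 * k + 1)) * x
        ≤ Real.pi / 2 / (2 * k + 1) * x :=
          mul_le_mul_of_nonneg_right (Real.sin_le hθ0) hx.le
      _ ≤ 2 / (2 * k + 1) * k := by gcongr; linarith
      _ ≤ 1 := by rw [div_mul_eq_mul_div, div_le_one (by positivity)]; linarith

/-- A state `φ` with `λ φ(j, b) = ∑ᵢ c_{ib} (s_i/‖s_i‖)ⱼ` for known `c` and `λ` can be prepared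
exactly by amplitude amplification with `O(√r / λ)` queries. -/
theorem exists_circuit_prepares {m n r : ℕ} [NeZero m] [NeZero n] (hr : 0 < r) {g : Fin r → Fin m}
    (hg : Function.Injective g) (c : Fin r → Fin 2 → ℝ) (hc : ∑ b, ∑ i, c i b ^ 2 = 1) (l : ℝ)
    (hl : 0 < l) :
    ∃ C : Circuit m n, (C.queries : ℝ) ≤ 3 + 2 * (Real.sqrt r / l) ∧
      ∀ (A : Matrix (Fin m) (Fin n) ℝ) (U : Matrix.unitaryGroup (Fin m × Fin n) ℂ),
        IsRowOracle A U → (∀ i, row A (g i) ≠ 0) → ∀ φ : QState (Fin n × Fin 2),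
          (∀ j b, ((∑ i, c i b * unitRow A g i j : ℝ) : ℂ) = l * φ.amp (j, b)) →
          C.Prepares U φ := by
  have hr' : (0 : ℝ) < Real.sqrt r := Real.sqrt_pos.2 (by exact_mod_cast hr)
  obtain ⟨k, θ, hk, hkθ, hcos, hsin, hsin1⟩ :=
    exists_amplification_angle (Real.sqrt r / l) (by positivity)
  -- The projected amplitude without ancilla is `l/√r`; the ancilla amplitude `γ₀` on `|0⟩` brings
  -- it down to exactly `sin θ`.
  set γ₀ := Real.sin θ * (Real.sqrt r / l) with hγ₀
  have hγ₀0 : 0 ≤ γ₀ := by positivity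
  set γ : Fin 2 → ℝ := ![γ₀, Real.sqrt (1 - γ₀ ^ 2)] with hγ
  have hγ2 : ∑ e, (γ e : ℂ) * γ e = 1 := by
    have : γ 0 * γ 0 + γ 1 * γ 1 = 1 := by
      simp only [hγ, Matrix.cons_val_zero, Matrix.cons_val_one]
      rw [Real.mul_self_sqrt (by nlinarith)]
      ring
    rw [Fin.sum_univ_two]
    exact_mod_cast this
  set u : Fin m → ℝ := extendZero g fun _ => 1 / Real.sqrt r with hu
  have hug : ∀ i, u (g i) = 1 / Real.sqrt r := fun i => extendZero_apply hg _ i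
  have huu : ∑ a, (u a : ℂ) * u a = 1 := by
    conv_lhs => enter [2, a]; rw [hu]
    rw [sum_mul_extendZero]
    simp only [extendZero_apply hg]
    rw [Finset.sum_const, Finset.card_univ, Fintype.card_fin, nsmul_eq_mul, ← Complex.ofReal_mul,
      div_mul_div_comm, Real.mul_self_sqrt (by positivity)]
    have : (r : ℂ) ≠ 0 := by exact_mod_cast hr.ne'
    push_cast
    field_simp
  set χ : (Fin m × Fin n) × (Fin 2 × Fin 2) → ℂ := fun p =>
    if p.1.2 = 0 then (extendZero g (fun i => c i p.2.1) p.1.1 : ℂ) * γ p.2.2 else 0 with hχ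
  have hχstar : star χ = χ := by
    ext p
    simp only [hχ, Pi.star_apply]
    split_ifs <;> simp
  have hχ1 : star χ ⬝ᵥ χ = 1 := by
    rw [hχstar]
    have h1 : ∀ b, ∑ a, (extendZero g (fun i => c i b) a : ℂ) * extendZero g (fun i => c i b) a =
        ∑ i, (c i b : ℂ) ^ 2 := by
      intro b
      rw [sum_mul_extendZero]
      simp only [extendZero_apply hg, sq]
    have h2 : ∑ b, ∑ i, (c i b : ℂ) ^ 2 = 1 := by exact_mod_cast hc
    calc χ ⬝ᵥ χ = ∑ a, ∑ b, ∑ e, (extendZero g (fun i => c i b) a *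
          extendZero g (fun i => c i b) a : ℂ) * (γ e * γ e) := by
          simp only [dotProduct, Fintype.sum_prod_type, hχ]
          refine Finset.sum_congr rfl fun a _ => ?_
          rw [Finset.sum_eq_single 0]
          · refine Finset.sum_congr rfl fun b _ => Finset.sum_congr rfl fun e _ => ?_
            simp only [if_true]
            ring
          · intro j _ hj; simp [hj]
          · simp
      _ = 1 := by
          simp only [← Finset.mul_sum, hγ2, mul_one]
          rw [Finset.sum_comm]
          simp only [h1, h2]
  have hb0 : star (fun p : (Fin m × Fin n) × (Fin 2 × Fin 2) =>
      if p = ((0, 0), (0, 0)) then (1 : ℂ) else 0) =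
      fun p : (Fin m × Fin n) × (Fin 2 × Fin 2) => if p = ((0, 0), (0, 0)) then (1 : ℂ) else 0 := by
    ext p
    simp only [Pi.star_apply]
    split_ifs <;> simp
  obtain ⟨V, hV⟩ := exists_unitary_mulVec_eq
    (fun p : (Fin m × Fin n) × (Fin 2 × Fin 2) => if p = ((0, 0), (0, 0)) then (1 : ℂ) else 0) χ
    (by rw [hb0]; simp [dotProduct]) hχ1 (by rw [hb0, hχstar, dotProduct_comm])
  obtain ⟨R, hR⟩ := exists_unitary_reflection χ hχ1
  obtain ⟨S, hS⟩ := exists_unitary_one_sub (goodProj n u) (conjTranspose_goodProj n u)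
    (goodProj_mul_self n u huu)
  have hustar : star (fun a => (u a : ℂ)) = fun a => (u a : ℂ) := by
    ext a; simp
  have he0 : star (fun a : Fin m => if a = 0 then (1 : ℂ) else 0) =
      fun a : Fin m => if a = 0 then (1 : ℂ) else 0 := by
    ext a
    simp only [Pi.star_apply]
    split_ifs <;> simp
  -- After amplification the index register holds the uniform superposition `u`, the same for every
  -- `A`; `T` returns it to `|0⟩`.
  obtain ⟨T, hT⟩ := exists_unitary_mulVec_eq (fun a => (u a : ℂ))
    (fun a : Fin m => if a = 0 then (1 : ℂ) else 0) (by rw [hustar]; exact huu)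
    (by rw [he0]; simp [dotProduct]) (by rw [hustar, he0, dotProduct_comm])
  -- The first two gates produce the initial state `ψ`. Each block is one Grover iterate: `S`
  -- reflects about the good subspace, and inverse query, `R`, query is the reflection about `ψ`, as
  -- `R` conjugated by the oracle. The total is `1 + 2k` queries. None of the gates depends on `A`,
  -- `U` or `φ`.
  refine ⟨⟨1, [Gate.free V, Gate.query] ++ (List.replicate k
    [Gate.free S, Gate.queryInv, Gate.free R, Gate.query]).flatten ++
      [Gate.free (kron (kron T 1) 1)]⟩, ?_, ?_⟩
  · have : Circuit.queries (⟨1, [Gate.free V, Gate.query] ++ (List.replicate k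
        [Gate.free S, Gate.queryInv, Gate.free R, Gate.query]).flatten ++
          [Gate.free (kron (kron T 1) 1)]⟩ : Circuit m n) = 1 + k * 2 := by
      simp [Circuit.queries, Gate.cost, List.map_flatten, List.sum_flatten]
    rw [this]
    push_cast
    linarith
  intro A U hU hA φ hφ
  set W : Matrix.unitaryGroup ((Fin m × Fin n) × (Fin 2 × Fin 2)) ℂ := kron U 1 with hW
  set ψ : (Fin m × Fin n) × (Fin 2 × Fin 2) → ℂ := (W : Matrix _ _ ℂ) *ᵥ χ with hψ
  set G : (Fin m × Fin n) × (Fin 2 × Fin 2) → ℂ := fun p =>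
    if p.2.2 = 0 then u p.1.1 * φ.amp (p.1.2, p.2.1) else 0 with hG
  have hψ1 : star ψ ⬝ᵥ ψ = 1 := by
    rw [hψ, Matrix.star_mulVec, ← Matrix.dotProduct_mulVec, Matrix.mulVec_mulVec,
      ← Matrix.star_eq_conjTranspose, Matrix.UnitaryGroup.star_mul_self, Matrix.one_mulVec, hχ1]
  -- Only column `0` of the oracle at the nonzero rows `g i` is used, which is all that
  -- `IsRowOracle` fixes.
  have hψa : ∀ a j b e, ψ ((a, j), (b, e)) =
      ∑ i, if a = g i then ((c i b * unitRow A g i j : ℝ) : ℂ) * γ e else 0 := by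
    intro a j b e
    have h1 : ψ ((a, j), (b, e)) = ∑ q, (U : Matrix _ _ ℂ) (a, j) q * χ (q, (b, e)) := by
      rw [hψ, hW]
      simp only [kron, Matrix.mulVec, dotProduct, Matrix.kroneckerMap_apply]
      rw [Fintype.sum_prod_type]
      refine Finset.sum_congr rfl fun q _ => ?_
      rw [Finset.sum_eq_single (b, e)]
      · simp
      · intro x _ hx
        have : (1 : Matrix (Fin 2 × Fin 2) (Fin 2 × Fin 2) ℂ) (b, e) x = 0 :=
          Matrix.one_apply_ne hx.symm
        simp [this]
      · simp
    rw [h1, Fintype.sum_prod_type]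
    have h2 : ∀ a', ∑ j', U.1 (a, j) (a', j') * χ ((a', j'), (b, e)) =
        (U.1 (a, j) (a', 0) * γ e) * extendZero g (fun i => c i b) a' := by
      intro a'
      rw [Finset.sum_eq_single 0]
      · simp only [hχ, if_true]; ring
      · intro j' _ hj; simp [hχ, hj]
      · simp
    simp only [h2]
    rw [sum_mul_extendZero]
    refine Finset.sum_congr rfl fun i _ => ?_
    rw [hU (g i) (hA i)]
    simp only
    split_ifs with h
    · rw [← Complex.ofReal_mul, ← Complex.ofReal_mul, ← Complex.ofReal_mul]
      congr 1
      simp [unitRow, row]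
      ring
    · simp
  have hPψ : goodProj n u *ᵥ ψ = (Real.sin θ : ℂ) • G := by
    ext ⟨⟨a, j⟩, ⟨b, e⟩⟩
    rw [goodProj_mulVec]
    by_cases he : e = 0
    · subst he
      have h1 : ∑ a', (u a' : ℂ) * ψ ((a', j), (b, 0)) = Real.sin θ * φ.amp (j, b) := by
        simp only [hψa, Finset.mul_sum]
        rw [Finset.sum_comm]
        have h2 : ∀ i, (∑ a', (u a' : ℂ) *
            if a' = g i then ((c i b * unitRow A g i j : ℝ) : ℂ) * γ 0 else 0) =
            ((c i b * unitRow A g i j : ℝ) : ℂ) * (γ₀ / Real.sqrt r : ℝ) := by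
          intro i
          rw [Finset.sum_eq_single (g i)]
          · rw [if_pos rfl, hug]
            simp only [hγ, Matrix.cons_val_zero]
            push_cast
            ring
          · intro a' _ ha; simp [ha]
          · simp
        simp only [h2]
        rw [← Finset.sum_mul, ← Complex.ofReal_sum, hφ]
        have h3 : l * (γ₀ / Real.sqrt r) = Real.sin θ := by
          rw [hγ₀]; field_simp
        rw [← h3]
        push_cast
        ring
      simp only [if_true, h1, hG, Pi.smul_apply, smul_eq_mul]
      ring
    · simp [he, hG]
  have hPG : goodProj n u *ᵥ G = G := by
    ext ⟨⟨a, j⟩, ⟨b, e⟩⟩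
    rw [goodProj_mulVec]
    simp only [hG, if_true, ← mul_assoc, ← Finset.sum_mul, huu, one_mul]
  have hG1 : star G ⬝ᵥ G = 1 := by
    have h1 := φ.star_amp_dotProduct
    simp only [dotProduct, Fintype.sum_prod_type, Pi.star_apply] at h1
    have h2 : star G ⬝ᵥ G =
        ∑ a, ∑ j, ∑ b, ((u a : ℂ) * u a) * (star (φ.amp (j, b)) * φ.amp (j, b)) := by
      simp only [dotProduct, Fintype.sum_prod_type, Pi.star_apply, hG]
      refine Finset.sum_congr rfl fun a _ => Finset.sum_congr rfl fun j _ =>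
        Finset.sum_congr rfl fun b _ => ?_
      rw [Fin.sum_univ_two]
      simp [mul_mul_mul_comm]
    rw [h2]
    simp only [← Finset.mul_sum, h1, mul_one, huu]
  have hblock : ∀ x, [Gate.free S, Gate.queryInv, Gate.free R, Gate.query].foldl
      (fun x G => ((Gate.unitary (w := 1) U G : Matrix.unitaryGroup _ ℂ) : Matrix _ _ ℂ) *ᵥ x) x =
      (2 * (star ψ ⬝ᵥ (x - (2 : ℂ) • (goodProj n u *ᵥ x)))) • ψ -
        (x - (2 : ℂ) • (goodProj n u *ᵥ x)) := by
    intro x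
    change W.1 *ᵥ R.1 *ᵥ (kron U⁻¹ 1).1 *ᵥ S.1 *ᵥ x = _
    rw [hS, kron_inv_one, ← hW, hR, Matrix.mulVec_sub, Matrix.mulVec_smul,
      coe_inv_mulVec_coe_mulVec, Matrix.UnitaryGroup.inv_val, Matrix.star_eq_conjTranspose,
      Matrix.dotProduct_mulVec, ← Matrix.star_mulVec]
  have hrun : (Circuit.run (⟨1, [Gate.free V, Gate.query] ++ (List.replicate k
      [Gate.free S, Gate.queryInv, Gate.free R, Gate.query]).flatten ++
        [Gate.free (kron (kron T 1) 1)]⟩ : Circuit m n) U).amp =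
      (kron (kron T (1 : Matrix.unitaryGroup (Fin n) ℂ))
        (1 : Matrix.unitaryGroup (Fin 2 × Fin 2) ℂ)).1 *ᵥ G := by
    rw [Circuit.run, foldl_apply_amp, List.foldl_append, List.foldl_append,
      foldl_flatten_replicate]
    have h0 : ([Gate.free V, Gate.query] : List (Gate m n 1)).foldl
        (fun x G => (G.unitary U : Matrix _ _ ℂ) *ᵥ x)
        (QState.basis ((0, 0), (0, 0))).amp = ψ := by
      change W.1 *ᵥ V.1 *ᵥ _ = _
      rw [hψ, ← hV]
      rfl
    -- At `(2k+1)θ = π/2` the cosine vanishes, so the state is exactly `G`.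
    rw [h0, grover_iterate (goodProj n u) (conjTranspose_goodProj n u) ψ G θ hcos hψ1 hG1 hPψ hPG _
      hblock, hkθ]
    simp [Gate.unitary]
  intro a j b e
  rw [hrun]
  have h1 : ((kron (kron T (1 : Matrix.unitaryGroup (Fin n) ℂ))
      (1 : Matrix.unitaryGroup (Fin 2 × Fin 2) ℂ)).1 *ᵥ G) ((a, j), (b, e)) =
      ∑ a', T.1 a a' * G ((a', j), (b, e)) := by
    simp only [kron, Matrix.mulVec, dotProduct, Matrix.kroneckerMap_apply]
    rw [Fintype.sum_prod_type, Fintype.sum_prod_type]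
    refine Finset.sum_congr rfl fun a' _ => ?_
    rw [Finset.sum_eq_single j, Finset.sum_eq_single (b, e)]
    · simp
    · intro x _ hx
      have : (1 : Matrix (Fin 2 × Fin 2) (Fin 2 × Fin 2) ℂ) (b, e) x = 0 :=
        Matrix.one_apply_ne hx.symm
      simp [this]
    · simp
    · intro x _ hx
      have : (1 : Matrix (Fin n) (Fin n) ℂ) j x = 0 := Matrix.one_apply_ne hx.symm
      simp [this]
    · simp
  have h2 := congrFun hT a
  simp only [Matrix.mulVec, dotProduct] at h2
  rw [h1]
  by_cases he : e = 0
  · simp only [hG, he, if_true, and_true, ← mul_assoc, ← Finset.sum_mul, h2]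
    split_ifs <;> simp
  · have he' : ¬ (a = 0 ∧ e = 0) := fun h => he h.2
    rw [if_neg he']
    exact Finset.sum_eq_zero fun a' _ => by
      have : G ((a', j), (b, e)) = 0 := if_neg he
      rw [this, mul_zero]

/-! ### The Gram matrix, the transition matrix and the orthonormal system -/

/-- The least singular value of a positive operator bounds its quadratic form from below. -/
theorem singularValues_mul_norm_sq_le {E : Type*} [NormedAddCommGroup E] [InnerProductSpace ℝ E]
    [FiniteDimensional ℝ E] {T : E →ₗ[ℝ] E} (hT : T.IsPositive) {r : ℕ} (hr : 0 < r)
    (hE : Module.finrank ℝ E = r) (x : E) :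
    T.singularValues (r - 1) * ‖x‖ ^ 2 ≤ ⟪x, T x⟫_ℝ := by
  have hS := hT.isSymmetric
  have hle : ∀ i, T.singularValues (r - 1) ≤ hS.eigenvalues hE i := by
    intro i
    -- Squares of eigenvalues of `T` are eigenvalues of `T* T`, whose ordered eigenvalues are the
    -- squared singular values; index `r - 1` is the least of them.
    have hev : Module.End.HasEigenvalue (LinearMap.adjoint T ∘ₗ T)
        (((hS.eigenvalues hE i) ^ 2 : ℝ)) := by
      refine Module.End.hasEigenvalue_of_hasEigenvector (x := hS.eigenvectorBasis hE i) ⟨?_, ?_⟩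
      · rw [Module.End.mem_eigenspace_iff, hT.adjoint_eq, LinearMap.comp_apply,
          hS.apply_eigenvectorBasis]
        simp only [RCLike.ofReal_real_eq_id, id_eq, map_smul]
        rw [hS.apply_eigenvectorBasis, smul_smul, sq]
        rfl
      · exact (hS.eigenvectorBasis hE).orthonormal.ne_zero i
    obtain ⟨k, hk⟩ := T.isSymmetric_adjoint_comp_self.exists_eigenvalues_eq hE hev
    have hk' : T.isSymmetric_adjoint_comp_self.eigenvalues hE k = hS.eigenvalues hE i ^ 2 := hk
    have h1 := T.sq_singularValues_of_lt hE (Nat.sub_lt hr one_pos)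
    have h2 : T.isSymmetric_adjoint_comp_self.eigenvalues hE ⟨r - 1, Nat.sub_lt hr one_pos⟩ ≤
        T.isSymmetric_adjoint_comp_self.eigenvalues hE k :=
      T.isSymmetric_adjoint_comp_self.eigenvalues_antitone hE
        (Fin.le_def.2 (Nat.le_sub_one_of_lt k.2))
    have h3 := hT.nonneg_eigenvalues hE i
    exact le_of_sq_le_sq (by rw [h1, ← hk']; exact h2) h3
  set b := hS.eigenvectorBasis hE with hb
  have h1 : ⟪x, T x⟫_ℝ = ∑ i, hS.eigenvalues hE i * ⟪b i, x⟫_ℝ ^ 2 := by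
    rw [← b.sum_inner_mul_inner]
    refine Finset.sum_congr rfl fun i _ => ?_
    rw [← hS (b i) x, hb, hS.apply_eigenvectorBasis, ← hb, inner_smul_left, real_inner_comm]
    simp
    ring
  have h2 : ‖x‖ ^ 2 = ∑ i, ⟪b i, x⟫_ℝ ^ 2 := by
    rw [← b.sum_sq_norm_inner_right x]
    simp
  rw [h1, h2, Finset.mul_sum]
  exact Finset.sum_le_sum fun i _ => mul_le_mul_of_nonneg_right (hle i) (sq_nonneg _)

section Basis

variable {m n r : ℕ} {A : Matrix (Fin m) (Fin n) ℝ} {g : Fin r → Fin m}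

theorem orthonormal_orthoRow (h : LinearIndependent ℝ fun i => row A (g i)) :
    Orthonormal ℝ (orthoRow A g) :=
  InnerProductSpace.gramSchmidtNormed_orthonormal (linearIndependent_unitRow h)

theorem norm_unitRow (h : LinearIndependent ℝ fun i => row A (g i)) (i : Fin r) :
    ‖unitRow A g i‖ = 1 := by
  rw [unitRow, norm_smul, norm_inv, norm_norm, inv_mul_cancel₀]
  exact norm_ne_zero_iff.2 (h.ne_zero i)

/-- The right side is the quadratic form of the Gram matrix at `x`. -/
theorem sigmaMin_mul_sum_sq_le (hr : 0 < r) (x : Fin r → ℝ) :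
    sigmaMin (gramC A g) * ∑ i, x i ^ 2 ≤ ‖∑ i, x i • unitRow A g i‖ ^ 2 := by
  have hpos : (Matrix.toEuclideanLin (gramC A g)).IsPositive :=
    Matrix.isPositive_toEuclideanLin_iff.2 (Matrix.posSemidef_gram ℝ _)
  have h := singularValues_mul_norm_sq_le hpos hr (by simp) (WithLp.toLp 2 x)
  rw [EuclideanSpace.real_norm_sq_eq] at h
  refine h.trans_eq ?_
  rw [← real_inner_self_eq_norm_sq, ← Matrix.star_dotProduct_gram_mulVec, Matrix.toLpLin_apply]
  simp only [gramC, EuclideanSpace.inner_toLp_toLp, dotProduct_comm]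

theorem sigmaMin_pos (hr : 0 < r) (h : LinearIndependent ℝ fun i => row A (g i)) :
    0 < sigmaMin (gramC A g) := by
  have hdet : IsUnit (gramC A g).det :=
    (Matrix.det_gram_ne_zero_iff_linearIndependent.2 (linearIndependent_unitRow h)).isUnit
  refine (LinearMap.injective_iff_forall_lt_finrank_singularValues_pos _).1 ?_ _ (by simp; omega)
  intro x y hxy
  have h1 : gramC A g *ᵥ x.ofLp = gramC A g *ᵥ y.ofLp := by
    simpa [Matrix.toLpLin_apply] using hxy
  have h2 := congrArg (fun z => (gramC A g)⁻¹ *ᵥ z) h1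
  simp only [Matrix.mulVec_mulVec, Matrix.nonsing_inv_mul _ hdet, Matrix.one_mulVec] at h2
  exact WithLp.ofLp_injective 2 h2

/-- The quadratic form of `C` is `1` at a coordinate vector. The bound lets additive constants in
query counts be absorbed in `σ_min(C)^(-1/2)`. -/
theorem sigmaMin_le_one (hr : 0 < r) (h : LinearIndependent ℝ fun i => row A (g i)) :
    sigmaMin (gramC A g) ≤ 1 := by
  have h1 := sigmaMin_mul_sum_sq_le (A := A) (g := g) hr (Pi.single ⟨0, hr⟩ 1)
  simpa [Pi.single_apply, norm_unitRow h] using h1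

/-- A column of `Z` lists the coefficients of the unit vector `t_j`, so the quadratic form of `C`
equals `1` there. This is the source of the exponent `-1/2` in the query bound. -/
theorem sigmaMin_mul_sum_sq_transition_le (hr : 0 < r)
    (h : LinearIndependent ℝ fun i => row A (g i)) (j : Fin r) :
    sigmaMin (gramC A g) * ∑ i, transition A g i j ^ 2 ≤ 1 := by
  have h1 := sigmaMin_mul_sum_sq_le (A := A) (g := g) hr fun i => transition A g i j
  rwa [← orthoRow_eq_sum h, norm_orthoRow h, one_pow] at h1

theorem sum_sq_transition_pos (h : LinearIndependent ℝ fun i => row A (g i)) (j : Fin r) :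
    0 < ∑ i, transition A g i j ^ 2 := by
  refine lt_of_le_of_ne (Finset.sum_nonneg fun i _ => sq_nonneg _) fun h0 => ?_
  have h1 : ∀ i, transition A g i j = 0 := fun i =>
    pow_eq_zero_iff two_ne_zero |>.1
      ((Finset.sum_eq_zero_iff_of_nonneg fun i _ => sq_nonneg _).1 h0.symm i (Finset.mem_univ i))
  have h2 := norm_orthoRow h j
  rw [orthoRow_eq_sum h] at h2
  simp [h1] at h2

/-- A combination of the normalized rows with coefficients `Z a` is the combination of the
orthonormal vectors with coefficients `a`. -/
theorem sum_transition_mulVec (h : LinearIndependent ℝ fun i => row A (g i)) (a : Fin r → ℝ) :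
    ∑ i, (transition A g *ᵥ a) i • unitRow A g i = ∑ j, a j • orthoRow A g j := by
  simp only [orthoRow_eq_sum h, Finset.smul_sum, Matrix.mulVec, dotProduct, Finset.sum_smul]
  rw [Finset.sum_comm]
  refine Finset.sum_congr rfl fun i _ => Finset.sum_congr rfl fun j _ => ?_
  rw [smul_smul, mul_comm]

/-- The span of the `t_i` lies in the row space and has the same dimension `r = rank A`, so the two
coincide. -/
theorem eq_sum_orthoRow (hA : A.rank = r) (h : LinearIndependent ℝ fun i => row A (g i))
    {v : EuclideanSpace ℝ (Fin n)} (hv : v ∈ Submodule.span ℝ (Set.range (row A))) :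
    v = ∑ i, ⟪orthoRow A g i, v⟫_ℝ • orthoRow A g i := by
  have hfin : Module.finrank ℝ (Submodule.span ℝ (Set.range (row A))) = r := by
    rw [← hA, A.rank_eq_finrank_span_row]
    have : Submodule.span ℝ (Set.range (row A)) = (Submodule.span ℝ (Set.range A.row)).map
        (WithLp.linearEquiv 2 ℝ (Fin n → ℝ)).symm.toLinearMap := by
      rw [Submodule.map_span, ← Set.range_comp]
      rfl
    rw [this]
    exact LinearEquiv.finrank_map_eq _ _
  have hle : Submodule.span ℝ (Set.range (orthoRow A g)) ≤
      Submodule.span ℝ (Set.range (row A)) := by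
    have h1 : Submodule.span ℝ (Set.range (orthoRow A g)) =
        Submodule.span ℝ (Set.range (unitRow A g)) := by
      rw [← InnerProductSpace.span_gramSchmidt ℝ (unitRow A g),
        ← InnerProductSpace.span_gramSchmidtNormed_range]
      rfl
    rw [h1, Submodule.span_le]
    rintro _ ⟨i, rfl⟩
    exact Submodule.smul_mem _ _ (Submodule.subset_span ⟨g i, rfl⟩)
  have heq : Submodule.span ℝ (Set.range (orthoRow A g)) =
      Submodule.span ℝ (Set.range (row A)) := by
    refine Submodule.eq_of_le_of_finrank_eq hle ?_
    rw [hfin, finrank_span_eq_card (orthonormal_orthoRow h).linearIndependent, Fintype.card_fin]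
  rw [← heq] at hv
  obtain ⟨c, hc⟩ := (Submodule.mem_span_range_iff_exists_fun ℝ).1 hv
  have h1 : ∀ i, ⟪orthoRow A g i, v⟫_ℝ = c i := fun i => by
    rw [← hc, (orthonormal_orthoRow h).inner_right_fintype]
  simp only [h1, hc]

theorem sum_sq_inner_orthoRow (hA : A.rank = r) (h : LinearIndependent ℝ fun i => row A (g i))
    {v : EuclideanSpace ℝ (Fin n)} (hv : v ∈ Submodule.span ℝ (Set.range (row A)))
    (hv1 : ‖v‖ = 1) : ∑ i, ⟪orthoRow A g i, v⟫_ℝ ^ 2 = 1 := by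
  have h1 : ⟪v, v⟫_ℝ = ∑ i, ⟪orthoRow A g i, v⟫_ℝ ^ 2 := by
    conv_lhs => enter [2]; rw [eq_sum_orthoRow hA h hv]
    rw [sum_inner]
    refine Finset.sum_congr rfl fun i _ => ?_
    rw [real_inner_smul_left, sq]
  rw [← h1, real_inner_self_eq_norm_sq, hv1, one_pow]

theorem norm_sum_smul_orthoRow_sq (h : LinearIndependent ℝ fun i => row A (g i)) (a : Fin r → ℝ) :
    ‖∑ j, a j • orthoRow A g j‖ ^ 2 = ∑ j, a j ^ 2 := by
  rw [← real_inner_self_eq_norm_sq, sum_inner]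
  refine Finset.sum_congr rfl fun i _ => ?_
  rw [real_inner_smul_left, (orthonormal_orthoRow h).inner_right_fintype, sq]

end Basis

/-! ### Circuits for the input states of the tests -/

/-- Homogeneous form of `exists_circuit_prepares`: the weights have norm `M` and the combination has
norm `κ`, so that `l = κ/M`. -/
theorem exists_circuit_prepares_of_weights {m n r : ℕ} [NeZero m] [NeZero n] (hr : 0 < r)
    {g : Fin r → Fin m} (hg : Function.Injective g) (w : Fin r → Fin 2 → ℝ) (M κ : ℝ) (hM : 0 < M)
    (hw : ∑ b, ∑ i, w i b ^ 2 = M ^ 2) (hκ : 0 < κ) :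
    ∃ C : Circuit m n, (C.queries : ℝ) ≤ 3 + 2 * (Real.sqrt r * (M / κ)) ∧
      ∀ (A : Matrix (Fin m) (Fin n) ℝ) (U : Matrix.unitaryGroup (Fin m × Fin n) ℂ),
        IsRowOracle A U → (∀ i, row A (g i) ≠ 0) → ∀ φ : QState (Fin n × Fin 2),
          (∀ j b, (((∑ i, w i b • unitRow A g i) j : ℝ) : ℂ) = κ * φ.amp (j, b)) →
          C.Prepares U φ := by
  obtain ⟨C, hC, h⟩ := exists_circuit_prepares (n := n) hr hg (fun i b => w i b / M) (by
    simp only [div_pow, ← Finset.sum_div, hw]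
    exact div_self (by positivity)) (κ / M) (by positivity)
  refine ⟨C, hC.trans_eq ?_, fun A U hU hA φ hφ => h A U hU hA φ fun j b => ?_⟩
  · congr 2
    field_simp
  · have h1 : ∑ i, w i b / M * unitRow A g i j = (∑ i, w i b • unitRow A g i) j / M := by
      simp only [WithLp.ofLp_sum, Finset.sum_apply, PiLp.smul_apply, smul_eq_mul, Finset.sum_div]
      exact Finset.sum_congr rfl fun i _ => by ring
    rw [h1, Complex.ofReal_div, hφ]
    push_cast
    ring

section Preparation

variable {m n r : ℕ}

theorem inv_sqrt_sigmaMin_bounds {A : Matrix (Fin m) (Fin n) ℝ} {g : Fin r → Fin m} (hr : 0 < r)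
    (hA : LinearIndependent ℝ fun i => row A (g i)) :
    1 ≤ sigmaMin (gramC A g) ^ (-(1 / 2) : ℝ) ∧
      (sigmaMin (gramC A g) ^ (-(1 / 2) : ℝ)) ^ 2 * sigmaMin (gramC A g) = 1 := by
  have h0 := sigmaMin_pos hr hA
  refine ⟨Real.one_le_rpow_of_pos_of_le_one_of_nonpos h0 (sigmaMin_le_one hr hA) (by norm_num), ?_⟩
  rw [← Real.rpow_natCast, ← Real.rpow_mul h0.le]
  norm_num
  rw [Real.rpow_neg_one, inv_mul_cancel₀ h0.ne']

/-- Here `x = M/κ` is at most `σ_min(C)^(-1/2)`. Weakening `√r` to `r` is harmless for the claimed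
bound, and `3` is absorbed since `r σ_min(C)^(-1/2) ≥ 1`. -/
theorem queries_le_of_weights {A : Matrix (Fin m) (Fin n) ℝ} {g : Fin r → Fin m} (hr : 0 < r)
    (hA : LinearIndependent ℝ fun i => row A (g i)) {x : ℝ} {q : ℕ}
    (hq : (q : ℝ) ≤ 3 + 2 * (Real.sqrt r * x)) (hx : x ^ 2 * sigmaMin (gramC A g) ≤ 1) :
    (q : ℝ) ≤ 5 * r * sigmaMin (gramC A g) ^ (-(1 / 2) : ℝ) := by
  obtain ⟨h1, h2⟩ := inv_sqrt_sigmaMin_bounds hr hA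
  have h0 := sigmaMin_pos hr hA
  set s := sigmaMin (gramC A g) ^ (-(1 / 2) : ℝ)
  have hxs : x ≤ s := by
    refine le_of_sq_le_sq ?_ (by linarith)
    rw [← h2] at hx
    exact le_of_mul_le_mul_right hx h0
  have hr1 : (1 : ℝ) ≤ r := by exact_mod_cast hr
  have hsr : Real.sqrt r ≤ r := Real.sqrt_le_iff.2 ⟨by linarith, by nlinarith⟩
  have h3 : Real.sqrt r * x ≤ r * s :=
    (mul_le_mul_of_nonneg_left hxs (Real.sqrt_nonneg _)).trans
      (mul_le_mul_of_nonneg_right hsr (by linarith))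
  nlinarith [mul_le_mul hr1 h1 zero_le_one (by linarith)]

theorem injective_of_linearIndependent {A : Matrix (Fin m) (Fin n) ℝ} {g : Fin r → Fin m}
    (hA : LinearIndependent ℝ fun i => row A (g i)) : Function.Injective g := fun _ _ hij =>
  hA.injective (congrArg (row A) hij)

/-- `|t_i⟩` can be prepared exactly by a circuit that depends on `A` through `Z` only. -/
theorem exists_circuit_orthoState (g : Fin r → Fin m) (Z : Matrix (Fin r) (Fin r) ℝ)
    (i : Fin r) :
    ∃ C : Circuit m n, ∀ [NeZero m] [NeZero n] (A : Matrix (Fin m) (Fin n) ℝ)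
      (hA : LinearIndependent ℝ fun i => row A (g i)), transition A g = Z →
      (C.queries : ℝ) ≤ 5 * r * sigmaMin (gramC A g) ^ (-(1 / 2) : ℝ) ∧
      ∀ U, IsRowOracle A U → C.Prepares U ((orthoState A g hA i).tensor (QState.basis 0)) := by
  have hr : 0 < r := i.pos
  by_cases hex : ∃ (_ : NeZero m) (_ : NeZero n) (A : Matrix (Fin m) (Fin n) ℝ)
      (_ : LinearIndependent ℝ fun i => row A (g i)), transition A g = Z
  swap
  -- If no admissible matrix has transition matrix `Z`, the claim is vacuous and an empty circuit
  -- serves. Otherwise a witness `A₀` provides nonzero columns of `Z` and injectivity of `g`, which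
  -- depend on `Z` and `g` only.
  · exact ⟨⟨0, []⟩, fun A hA hZ => (hex ⟨‹_›, ‹_›, A, hA, hZ⟩).elim⟩
  obtain ⟨_, _, A₀, hA₀, hZ₀⟩ := hex
  have hpos : 0 < ∑ j, Z j i ^ 2 := by rw [← hZ₀]; exact sum_sq_transition_pos hA₀ i
  obtain ⟨C, hC, h⟩ := exists_circuit_prepares_of_weights (n := n) hr
    (injective_of_linearIndependent hA₀) (fun j b => if b = 0 then Z j i else 0)
    (Real.sqrt (∑ j, Z j i ^ 2)) 1 (Real.sqrt_pos.2 hpos)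
    (by rw [Real.sq_sqrt hpos.le]; simp) one_pos
  refine ⟨C, fun A hA hZ => ⟨queries_le_of_weights hr hA hC ?_, fun U hU => ?_⟩⟩
  · rw [div_one, Real.sq_sqrt hpos.le, mul_comm, ← hZ]
    exact sigmaMin_mul_sum_sq_transition_le hr hA i
  · refine h A U hU hA.ne_zero _ fun j b => ?_
    by_cases hb : b = 0
    · simp only [hb, if_true, ← hZ, ← orthoRow_eq_sum hA]
      simp [QState.tensor, QState.basis, orthoState, QState.ofReal]
    · simp [hb, QState.tensor, QState.basis]

/-- `(|t_k⟩|0⟩ + |t_i⟩|1⟩)/√2` can be prepared exactly by a circuit that depends on `A` through `Z`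
only. -/
theorem exists_circuit_flagged (g : Fin r → Fin m) (Z : Matrix (Fin r) (Fin r) ℝ)
    (k i : Fin r) :
    ∃ C : Circuit m n, ∀ [NeZero m] [NeZero n] (A : Matrix (Fin m) (Fin n) ℝ)
      (hA : LinearIndependent ℝ fun i => row A (g i)), transition A g = Z →
      (C.queries : ℝ) ≤ 5 * r * sigmaMin (gramC A g) ^ (-(1 / 2) : ℝ) ∧
      ∀ U, IsRowOracle A U →
        C.Prepares U ((orthoState A g hA k).flagged (orthoState A g hA i)) := by
  have hr : 0 < r := i.pos
  by_cases hex : ∃ (_ : NeZero m) (_ : NeZero n) (A : Matrix (Fin m) (Fin n) ℝ)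
      (_ : LinearIndependent ℝ fun i => row A (g i)), transition A g = Z
  swap
  · exact ⟨⟨0, []⟩, fun A hA hZ => (hex ⟨‹_›, ‹_›, A, hA, hZ⟩).elim⟩
  obtain ⟨_, _, A₀, hA₀, hZ₀⟩ := hex
  have hpos : 0 < (∑ j, Z j k ^ 2) + ∑ j, Z j i ^ 2 := by
    rw [← hZ₀]; exact add_pos (sum_sq_transition_pos hA₀ k) (sum_sq_transition_pos hA₀ i)
  have h2 : (0 : ℝ) < Real.sqrt 2 := by positivity
  obtain ⟨C, hC, h⟩ := exists_circuit_prepares_of_weights (n := n) hr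
    (injective_of_linearIndependent hA₀) (fun j b => if b = 0 then Z j k else Z j i)
    (Real.sqrt ((∑ j, Z j k ^ 2) + ∑ j, Z j i ^ 2)) (Real.sqrt 2) (Real.sqrt_pos.2 hpos)
    (by rw [Real.sq_sqrt hpos.le]; simp) h2
  refine ⟨C, fun A hA hZ => ⟨queries_le_of_weights hr hA hC ?_, fun U hU => ?_⟩⟩
  -- The division by `κ² = 2` leaves the mean of the squared norms of two columns, so the bound for
  -- one column still applies.
  · rw [div_pow, Real.sq_sqrt hpos.le, Real.sq_sqrt zero_le_two, ← hZ]
    have h3 := sigmaMin_mul_sum_sq_transition_le hr hA i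
    have h4 := sigmaMin_mul_sum_sq_transition_le hr hA k
    linarith
  · have h3 : (Real.sqrt 2 : ℂ) ≠ 0 := by exact_mod_cast h2.ne'
    refine h A U hU hA.ne_zero _ fun j b => ?_
    by_cases hb : b = 0
    · simp only [hb, if_true, ← hZ, ← orthoRow_eq_sum hA]
      simp only [QState.flagged, orthoState, QState.ofReal, if_true]
      field_simp
    · simp only [hb, if_false, ← hZ, ← orthoRow_eq_sum hA]
      simp only [QState.flagged, orthoState, QState.ofReal, hb, if_false]
      field_simp

end Preparation

/-! ### Binomial expectations and tails -/

/-- The expectation of `F` under the binomial law with `N` trials and success probability `h`. -/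
def binomExp (N : ℕ) (h : ℝ) (F : ℕ → ℝ) : ℝ :=
  ∑ m ∈ Finset.range (N + 1), (N.choose m : ℝ) * (h ^ m * (1 - h) ^ (N - m)) * F m

/-- The probability of at least `s` successes in `N` trials with success probability `h`. -/
def binomTail (N : ℕ) (h : ℝ) (s : ℕ) : ℝ :=
  binomExp N h fun m => if s ≤ m then 1 else 0

theorem binomExp_zero (h : ℝ) (F : ℕ → ℝ) : binomExp 0 h F = F 0 := by
  simp [binomExp]

/-- Pascal's rule, that is, conditioning on one trial. Later inductions use only this recursion. -/
theorem binomExp_succ (N : ℕ) (h : ℝ) (F : ℕ → ℝ) :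
    binomExp (N + 1) h F = h * binomExp N h (fun m => F (m + 1)) + (1 - h) * binomExp N h F := by
  have e2 : (1 - h) * binomExp N h F =
      ∑ m ∈ Finset.range (N + 1 + 1), (N.choose m : ℝ) * (h ^ m * (1 - h) ^ (N + 1 - m)) * F m := by
    rw [Finset.sum_range_succ, Nat.choose_succ_self, binomExp, Finset.mul_sum]
    simp only [Nat.cast_zero, zero_mul, add_zero]
    refine Finset.sum_congr rfl fun m hm => ?_
    rw [Nat.succ_sub (Nat.lt_succ_iff.1 (Finset.mem_range.1 hm)), pow_succ]
    ring
  rw [e2, Finset.sum_range_succ' _ (N + 1), binomExp, Finset.sum_range_succ' _ (N + 1), binomExp,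
    Finset.mul_sum, ← add_assoc, ← Finset.sum_add_distrib]
  congr 1
  · refine Finset.sum_congr rfl fun m _ => ?_
    rw [Nat.choose_succ_succ, Nat.succ_sub_succ]
    push_cast
    ring
  · simp

theorem binomExp_add (N : ℕ) (h : ℝ) (F G : ℕ → ℝ) :
    binomExp N h (fun m => F m + G m) = binomExp N h F + binomExp N h G := by
  simp only [binomExp, mul_add, Finset.sum_add_distrib]

theorem binomExp_const_mul (N : ℕ) (h c : ℝ) (F : ℕ → ℝ) :
    binomExp N h (fun m => c * F m) = c * binomExp N h F := by
  simp only [binomExp, Finset.mul_sum]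
  exact Finset.sum_congr rfl fun m _ => by ring

theorem binomExp_one (N : ℕ) (h : ℝ) : binomExp N h (fun _ => 1) = 1 := by
  induction N with
  | zero => rw [binomExp_zero]
  | succ N ih => rw [binomExp_succ, ih]; ring

theorem binomExp_mono {N : ℕ} {h : ℝ} (h0 : 0 ≤ h) (h1 : h ≤ 1) {F G : ℕ → ℝ}
    (hFG : ∀ m, F m ≤ G m) : binomExp N h F ≤ binomExp N h G := by
  have : 0 ≤ 1 - h := by linarith
  exact Finset.sum_le_sum fun m _ => mul_le_mul_of_nonneg_left (hFG m) (by positivity)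

/-- Variance plus squared bias. The centre `c` is arbitrary because a success shifts it by one in
the induction. -/
theorem binomExp_sq_sub (N : ℕ) (h c : ℝ) :
    binomExp N h (fun m => ((m : ℝ) - c) ^ 2) = N * (h * (1 - h)) + (N * h - c) ^ 2 := by
  induction N generalizing c with
  | zero => rw [binomExp_zero]; simp
  | succ N ih =>
    rw [binomExp_succ, ih]
    have : (fun m : ℕ => (((m + 1 : ℕ) : ℝ) - c) ^ 2) = fun m : ℕ => ((m : ℝ) - (c - 1)) ^ 2 := by
      funext m; push_cast; ring
    rw [this, ih]
    push_cast
    ring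

theorem mul_one_sub_le_quarter (h : ℝ) : h * (1 - h) ≤ 1 / 4 := by
  nlinarith [sq_nonneg (h - 1 / 2)]

/-- Chebyshev's inequality for the binomial law. -/
theorem binomExp_le_of_sq {N : ℕ} {h : ℝ} (h0 : 0 ≤ h) (h1 : h ≤ 1) {a : ℝ}
    {F : ℕ → ℝ} (hF : ∀ m : ℕ, a ^ 2 * F m ≤ ((m : ℝ) - N * h) ^ 2) :
    a ^ 2 * binomExp N h F ≤ N / 4 := by
  rw [← binomExp_const_mul]
  refine (binomExp_mono h0 h1 hF).trans ?_
  rw [binomExp_sq_sub]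
  have := mul_le_mul_of_nonneg_left (mul_one_sub_le_quarter h) (Nat.cast_nonneg (α := ℝ) N)
  linarith

theorem binomTail_zero (N : ℕ) (h : ℝ) : binomTail N h 0 = 1 := by
  simp [binomTail, binomExp_one]

theorem binomTail_of_lt {N s : ℕ} (hs : N < s) (h : ℝ) : binomTail N h s = 0 := by
  rw [binomTail, binomExp]
  refine Finset.sum_eq_zero fun m hm => ?_
  have := Finset.mem_range.1 hm
  rw [if_neg (by omega), mul_zero]

theorem binomTail_antitone {N : ℕ} {h : ℝ} (h0 : 0 ≤ h) (h1 : h ≤ 1) {s t : ℕ} (hst : s ≤ t) :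
    binomTail N h t ≤ binomTail N h s :=
  binomExp_mono h0 h1 fun m => by split_ifs <;> first | omega | norm_num

theorem binomTail_nonneg {N : ℕ} {h : ℝ} (h0 : 0 ≤ h) (h1 : h ≤ 1) (s : ℕ) :
    0 ≤ binomTail N h s := by
  have : 0 ≤ 1 - h := by linarith
  rw [binomTail, binomExp]
  exact Finset.sum_nonneg fun m _ => mul_nonneg (by positivity) (by split_ifs <;> norm_num)

theorem binomTail_le_one {N : ℕ} {h : ℝ} (h0 : 0 ≤ h) (h1 : h ≤ 1) (s : ℕ) :
    binomTail N h s ≤ 1 :=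
  (binomTail_antitone h0 h1 (Nat.zero_le s)).trans_eq (binomTail_zero N h)

theorem one_sub_binomTail (N : ℕ) (h : ℝ) (s : ℕ) :
    1 - binomTail N h s = binomExp N h fun m => if m < s then 1 else 0 := by
  have : binomExp N h (fun m => if m < s then 1 else 0) + binomTail N h s = 1 := by
    rw [binomTail, ← binomExp_add]
    refine Eq.trans ?_ (binomExp_one N h)
    congr 1
    funext m
    split_ifs <;> first | omega | norm_num
  linarith

theorem binomTail_succ_succ (N : ℕ) (h : ℝ) (s : ℕ) :
    binomTail (N + 1) h (s + 1) = h * binomTail N h s + (1 - h) * binomTail N h (s + 1) := by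
  simp [binomTail, binomExp_succ]

/-- Conditioning on one trial gives a convex combination of two tails; a larger `h` shifts weight to
the larger one. -/
theorem binomTail_mono {N : ℕ} {h h' : ℝ} (h0 : 0 ≤ h) (hh : h ≤ h') (h1 : h' ≤ 1) (s : ℕ) :
    binomTail N h s ≤ binomTail N h' s := by
  induction N generalizing s with
  | zero => simp [binomTail, binomExp_zero]
  | succ N ih =>
    cases s with
    | zero => simp [binomTail_zero]
    | succ s =>
      rw [binomTail_succ_succ, binomTail_succ_succ]
      have h2 := ih s
      have h3 := ih (s + 1)
      have h4 := binomTail_antitone (N := N) (h0.trans hh) h1 (Nat.le_succ s)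
      nlinarith

/-- The likelihood ratio of two binomial laws on the upper tail. -/
theorem mul_binomTail_le {N s : ℕ} {p q : ℝ} (hq : 0 ≤ q) (hqp : q ≤ p) (hp : p < 1)
    (hs : N * p ≤ 2 * s - N) :
    ((p - q) * (2 * s - N - N * p)) * binomTail N ((1 + q) / 2) s ≤
      binomTail N ((1 + p) / 2) s := by
  rw [binomTail, ← binomExp_const_mul, binomTail, binomExp, binomExp]
  refine Finset.sum_le_sum fun m hm => ?_
  split_ifs with hsm
  swap
  · simp
  have hmN : m ≤ N := Nat.lt_succ_iff.1 (Finset.mem_range.1 hm)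
  rw [mul_one, mul_one, mul_assoc]
  refine mul_le_mul_of_nonneg_left ?_ (Nat.cast_nonneg _)
  have hp1 : 0 < 1 + p := by linarith
  have hp2 : 0 < 1 - p := by linarith
  -- Chosen so that `1 + q = (1 + p)(1 - x)` and `1 - q = (1 - p)(1 + y)`; then `1 + z ≤ exp z`
  -- bounds the likelihood ratio of `q` to `p` at `m` successes by `exp (-E)`.
  set x := (p - q) / (1 + p) with hx
  set y := (p - q) / (1 - p) with hy
  have h1 : (1 + q) / 2 ≤ (1 + p) / 2 * Real.exp (-x) := by
    have : (1 + q) / 2 = (1 + p) / 2 * (-x + 1) := by rw [hx]; field_simp; ring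
    rw [this]
    exact mul_le_mul_of_nonneg_left (Real.add_one_le_exp _) (by positivity)
  have h2 : 1 - (1 + q) / 2 ≤ (1 - (1 + p) / 2) * Real.exp y := by
    have : 1 - (1 + q) / 2 = (1 - (1 + p) / 2) * (y + 1) := by rw [hy]; field_simp; ring
    rw [this]
    exact mul_le_mul_of_nonneg_left (Real.add_one_le_exp _) (by linarith)
  set E : ℝ := m * x - (N - m : ℕ) * y with hE
  have h3 : ((1 + q) / 2) ^ m * (1 - (1 + q) / 2) ^ (N - m) ≤
      (((1 + p) / 2) ^ m * (1 - (1 + p) / 2) ^ (N - m)) * Real.exp (-E) := by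
    calc _ ≤ ((1 + p) / 2 * Real.exp (-x)) ^ m * ((1 - (1 + p) / 2) * Real.exp y) ^ (N - m) := by
          refine mul_le_mul (pow_le_pow_left₀ (by positivity) h1 _)
            (pow_le_pow_left₀ (by linarith) h2 _) (pow_nonneg (by linarith) _) (by positivity)
      _ = _ := by
          rw [mul_pow, mul_pow, ← Real.exp_nat_mul, ← Real.exp_nat_mul, mul_mul_mul_comm,
            ← Real.exp_add]
          congr 2
          rw [hE]; ring
  -- `E` equals `(p - q)(2m - N - Np)/(1 - p²)`, which increases with `m`, and the denominator is at
  -- most `1`.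
  have h4 : (p - q) * (2 * s - N - N * p) ≤ E := by
    have e : E = (p - q) * (2 * m - N - N * p) / ((1 + p) * (1 - p)) := by
      rw [hE, hx, hy, Nat.cast_sub hmN]; field_simp; ring
    have hsm' : (s : ℝ) ≤ m := by exact_mod_cast hsm
    rw [e, le_div_iff₀ (by positivity)]
    have h5 : (p - q) * (2 * s - N - N * p) ≤ (p - q) * (2 * m - N - N * p) :=
      mul_le_mul_of_nonneg_left (by linarith) (by linarith)
    have h6 : 0 ≤ (p - q) * (2 * s - N - N * p) := mul_nonneg (by linarith) (by linarith)
    nlinarith [mul_nonneg h6 (sq_nonneg p)]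
  have h7 : (p - q) * (2 * s - N - N * p) ≤ Real.exp E :=
    h4.trans ((by linarith : E ≤ E + 1).trans (Real.add_one_le_exp E))
  have h8 : (0 : ℝ) ≤ ((1 + q) / 2) ^ m * (1 - (1 + q) / 2) ^ (N - m) :=
    mul_nonneg (by positivity) (pow_nonneg (by linarith) _)
  calc _ ≤ ((1 + q) / 2) ^ m * (1 - (1 + q) / 2) ^ (N - m) * Real.exp E := by
        rw [mul_comm (((1 + q) / 2) ^ m * (1 - (1 + q) / 2) ^ (N - m)) (Real.exp E)]
        calc _ = ((p - q) * (2 * s - N - N * p)) *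
              (((1 + q) / 2) ^ m * (1 - (1 + q) / 2) ^ (N - m)) := by ring
          _ ≤ _ := mul_le_mul_of_nonneg_right h7 h8
    _ ≤ (((1 + p) / 2) ^ m * (1 - (1 + p) / 2) ^ (N - m)) * Real.exp (-E) * Real.exp E :=
        mul_le_mul_of_nonneg_right h3 (Real.exp_pos _).le
    _ = _ := by rw [mul_assoc, ← Real.exp_add]; simp

/-- Consecutive tails are comparable below three quarters of the trials. -/
theorem binomTail_le_four_mul {N s : ℕ} {h : ℝ} (h0 : 1 / 2 ≤ h) (h1 : h ≤ 1)
    (hs : 4 * (s + 1) ≤ 3 * (N + 1)) (hsN : s + 1 ≤ N) :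
    binomTail N h s ≤ 4 * binomTail N h (s + 1) := by
  have hb : ∀ t, t ≤ N → (N.choose t : ℝ) * (h ^ t * (1 - h) ^ (N - t)) ≤ binomTail N h t := by
    intro t ht
    have := Finset.single_le_sum (f := fun m => (N.choose m : ℝ) * (h ^ m * (1 - h) ^ (N - m)) *
      (if t ≤ m then 1 else 0)) (fun m _ => mul_nonneg (mul_nonneg (Nat.cast_nonneg _)
        (mul_nonneg (pow_nonneg (by linarith) _) (pow_nonneg (by linarith) _)))
        (by split_ifs <;> norm_num)) (Finset.mem_range.2 (Nat.lt_succ_of_le ht))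
    simpa [binomTail, binomExp] using this
  have hsplit : binomTail N h s =
      (N.choose s : ℝ) * (h ^ s * (1 - h) ^ (N - s)) + binomTail N h (s + 1) := by
    have h2 : (fun m => if s ≤ m then (1 : ℝ) else 0) =
        fun m => (if m = s then 1 else 0) + if s + 1 ≤ m then 1 else 0 := by
      funext m
      split_ifs <;> first | omega | norm_num
    rw [binomTail, h2, binomExp_add, binomTail]
    congr 1
    rw [binomExp, Finset.sum_eq_single s] <;> simp +contextual
    omega
  -- The ratio of consecutive binomial coefficients is `(s+1)/(N-s) ≤ 3`, and `(1 - h)/h ≤ 1`.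
  have h3 : (N.choose s : ℝ) * (h ^ s * (1 - h) ^ (N - s)) ≤
      3 * ((N.choose (s + 1) : ℝ) * (h ^ (s + 1) * (1 - h) ^ (N - (s + 1)))) := by
    have h4 : (N.choose (s + 1) : ℝ) * (s + 1) = N.choose s * (N - s : ℕ) := by
      exact_mod_cast Nat.choose_succ_right_eq N s
    have h5 : N - s = (N - (s + 1)) + 1 := by omega
    have h6 : ((s : ℝ) + 1) ≤ 3 * (N - s : ℕ) := by
      have : s + 1 ≤ 3 * (N - s) := by omega
      exact_mod_cast this
    have h7 : (N.choose s : ℝ) ≤ 3 * N.choose (s + 1) := by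
      have h8 : (0 : ℝ) < s + 1 := by positivity
      refine le_of_mul_le_mul_right ?_ h8
      calc (N.choose s : ℝ) * (s + 1) ≤ N.choose s * (3 * (N - s : ℕ)) :=
            mul_le_mul_of_nonneg_left h6 (Nat.cast_nonneg _)
        _ = 3 * (N.choose s * (N - s : ℕ)) := by ring
        _ = _ := by rw [← h4]; ring
    have h9 : h ^ s * (1 - h) ^ (N - s) ≤ h ^ (s + 1) * (1 - h) ^ (N - (s + 1)) := by
      rw [h5, pow_succ, pow_succ]
      have h10 : 0 ≤ h ^ s * (1 - h) ^ (N - (s + 1)) :=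
        mul_nonneg (pow_nonneg (by linarith) _) (pow_nonneg (by linarith) _)
      nlinarith
    calc _ ≤ (3 * (N.choose (s + 1) : ℝ)) * (h ^ (s + 1) * (1 - h) ^ (N - (s + 1))) :=
          mul_le_mul h7 h9 (mul_nonneg (pow_nonneg (by linarith) _) (pow_nonneg (by linarith) _))
            (by positivity)
      _ = _ := by ring
  have h11 := hb (s + 1) hsN
  linarith

/-! ### A threshold that separates large from small overlaps -/

theorem binomTail_le_of_mean_add_le {N s : ℕ} {h a : ℝ} (h0 : 0 ≤ h) (h1 : h ≤ 1) (ha : 0 ≤ a)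
    (hs : N * h + a ≤ s) : a ^ 2 * binomTail N h s ≤ N / 4 := by
  refine binomExp_le_of_sq h0 h1 fun m => ?_
  split_ifs with hm
  · have : (s : ℝ) ≤ m := by exact_mod_cast hm
    rw [mul_one]
    exact pow_le_pow_left₀ ha (by linarith) 2
  · rw [mul_zero]; positivity

theorem one_sub_binomTail_le_of_le_mean_sub {N s : ℕ} {h a : ℝ} (h0 : 0 ≤ h) (h1 : h ≤ 1)
    (ha : 0 ≤ a) (hs : s ≤ N * h - a) : a ^ 2 * (1 - binomTail N h s) ≤ N / 4 := by
  rw [one_sub_binomTail]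
  refine binomExp_le_of_sq h0 h1 fun m => ?_
  split_ifs with hm
  · have : (m : ℝ) ≤ s := by exact_mod_cast hm.le
    rw [mul_one, sub_sq_comm]
    exact pow_le_pow_left₀ ha (by linarith) 2
  · rw [mul_zero]; positivity

/-- For nonnegative `p_i` with sum `1`, some threshold `s` is, with high probability, not reached by
any index with `p_i < 1/(4r)`, but by some other index. The number `N` of trials need not exceed
`O(r²)`. -/
theorem exists_threshold {r : ℕ} (hr : 0 < r) (p : Fin r → ℝ) (hp0 : ∀ i, 0 ≤ p i)
    (hp : ∑ i, p i = 1) {δ : ℝ} (hδ₀ : 0 < δ) (hδ₁ : δ < 1) {N : ℕ}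
    (hN : 4096 * (r : ℝ) ^ 2 / δ ^ 2 ≤ N) :
    ∃ s, (∑ i, if p i < 1 / (4 * r) then binomTail N ((1 + p i) / 2) s else 0) +
      (∏ i, if p i < 1 / (4 * r) then 1 else 1 - binomTail N ((1 + p i) / 2) s) ≤ 3 / 4 * δ := by
  have hr0 : (0 : ℝ) < r := by exact_mod_cast hr
  have hr1 : (1 : ℝ) ≤ r := by exact_mod_cast hr
  have hp1 : ∀ i, p i ≤ 1 := fun i =>
    hp ▸ Finset.single_le_sum (fun j _ => hp0 j) (Finset.mem_univ i)
  set q : ℝ := 1 / (4 * r) with hq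
  have hqr : q * r = 1 / 4 := by rw [hq]; field_simp
  have hq0 : 0 < q := by positivity
  have hq4 : q ≤ 1 / 4 := by linarith [mul_le_mul_of_nonneg_left hr1 hq0.le]
  have hNδ : 4096 * (r : ℝ) ^ 2 ≤ N * δ ^ 2 := by
    rwa [div_le_iff₀ (by positivity)] at hN
  have hNr : 4096 * (r : ℝ) ^ 2 ≤ N * δ := by
    have : N * δ ^ 2 ≤ N * δ := mul_le_mul_of_nonneg_left (by nlinarith) (Nat.cast_nonneg _)
    linarith
  have hNr' : 4096 * (r : ℝ) ^ 2 ≤ N := by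
    have : N * δ ≤ N * 1 := mul_le_mul_of_nonneg_left hδ₁.le (Nat.cast_nonneg _)
    linarith
  have hN4096 : (4096 : ℝ) ≤ N := by nlinarith
  have hN0 : (0 : ℝ) < N := by linarith
  have hq2r : q ^ 2 * r ^ 2 = 1 / 16 := by rw [← mul_pow, hqr]; norm_num
  have hNq2 : 256 ≤ N * q ^ 2 := by
    linarith [mul_le_mul_of_nonneg_left hNr' (sq_nonneg q)]
  have hNq2δ : 256 ≤ N * q ^ 2 * δ := by
    linarith [mul_le_mul_of_nonneg_left hNr (sq_nonneg q)]
  have hh : ∀ x : ℝ, 0 ≤ x → x ≤ 1 → 0 ≤ (1 + x) / 2 ∧ (1 + x) / 2 ≤ 1 :=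
    fun x h0 h1 => ⟨by linarith, by linarith⟩
  have hhi := fun i => hh (p i) (hp0 i) (hp1 i)
  have hhq := hh q hq0.le (by linarith)
  have hex : ∃ s, binomTail N ((1 + q) / 2) s ≤ δ / (4 * r) :=
    ⟨N + 1, by rw [binomTail_of_lt (Nat.lt_succ_self N)]; positivity⟩
  classical
  -- Minimality makes the choice tight: the tail at `s` is small enough for a union bound over the
  -- bad indices, yet the tail at `s - 1` is not, which bounds the tail at `s` from below up to a
  -- constant.
  obtain ⟨s, hsle, hsmin⟩ : ∃ s, binomTail N ((1 + q) / 2) s ≤ δ / (4 * r) ∧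
      ∀ t < s, δ / (4 * r) < binomTail N ((1 + q) / 2) t :=
    ⟨Nat.find hex, Nat.find_spec hex, fun t ht => not_le.1 (Nat.find_min hex ht)⟩
  have hδr : δ / (4 * r) ≤ 1 / 4 := by
    rw [div_le_iff₀ (by positivity)]; nlinarith
  have hbad : (∑ i, if p i < q then binomTail N ((1 + p i) / 2) s else 0) ≤ δ / 4 := by
    calc _ ≤ ∑ _i : Fin r, δ / (4 * r) := by
          refine Finset.sum_le_sum fun i _ => ?_
          split_ifs with h
          · exact (binomTail_mono (hhi i).1 (by linarith) hhq.2 s).trans hsle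
          · positivity
      _ = δ / 4 := by
          rw [Finset.sum_const, Finset.card_univ, Fintype.card_fin, nsmul_eq_mul]
          field_simp
  have hfac : ∀ i, 0 ≤ (if p i < q then 1 else 1 - binomTail N ((1 + p i) / 2) s) ∧
      (if p i < q then 1 else 1 - binomTail N ((1 + p i) / 2) s) ≤ 1 := by
    intro i
    have h1 := binomTail_nonneg (N := N) (hhi i).1 (hhi i).2 s
    have h2 := binomTail_le_one (N := N) (hhi i).1 (hhi i).2 s
    split_ifs <;> constructor <;> linarith
  refine ⟨s, ?_⟩
  suffices hgood : (∏ i, if p i < q then 1 else 1 - binomTail N ((1 + p i) / 2) s) ≤ δ / 2 by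
    linarith
  set d : ℝ := 2 * s - N with hd
  -- The surplus `d = 2s - N` is comparable to the mean surplus `Nq` or larger: a lower `s` would be
  -- reached with probability at least `1/2`.
  have hdq : 3 / 4 * (N * q) ≤ d := by
    by_contra! hlt
    have h1 := one_sub_binomTail_le_of_le_mean_sub (N := N) (s := s) (a := N * q / 8) hhq.1 hhq.2
      (by positivity) (by linarith)
    have h2 : 1 / 2 ≤ 1 - binomTail N ((1 + q) / 2) s := by linarith
    have h3 : (N * q / 8) ^ 2 * (1 / 2) ≤ N / 4 :=
      (mul_le_mul_of_nonneg_left h2 (sq_nonneg _)).trans h1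
    have h4 : (N * q / 8) ^ 2 = N * (N * q ^ 2) / 64 := by ring
    rw [h4] at h3
    linarith [mul_le_mul_of_nonneg_left hNq2 hN0.le]
  have hs0 : 1 ≤ s := by
    by_contra! h
    have : s = 0 := by omega
    rw [this, binomTail_zero] at hsle
    linarith
  obtain ⟨t, rfl⟩ : ∃ t, s = t + 1 := ⟨s - 1, by omega⟩
  have ht := hsmin t (Nat.lt_succ_self t)
  -- Since `q ≤ 1/4`, the mean is at most `5N/8`. A threshold near `3N/4` would make the tail at `t`
  -- smaller, by Chebyshev, than minimality of `s` allows.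
  have hst : 4 * (t + 1) ≤ 3 * (N + 1) := by
    by_contra! hlt
    have hlt' : (3 : ℝ) * (N + 1) < 4 * (t + 1) := by exact_mod_cast hlt
    have h1 := binomTail_le_of_mean_add_le (N := N) (s := t) (a := N / 16) hhq.1 hhq.2
      (by positivity) (by linarith [mul_le_mul_of_nonneg_left hq4 hN0.le])
    have h2 : (N / 16 : ℝ) ^ 2 * (δ / (4 * r)) ≤ N / 4 :=
      (mul_le_mul_of_nonneg_left ht.le (sq_nonneg _)).trans h1
    have h3 : (N / 16 : ℝ) ^ 2 * (δ / (4 * r)) = N * (N * δ) / (1024 * r) := by field_simp; norm_num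
    rw [h3, div_le_iff₀ (by positivity)] at h2
    have h4 : (256 : ℝ) * r < N * δ := by
      linarith [mul_le_mul_of_nonneg_left hr1 hr0.le]
    linarith [mul_lt_mul_of_pos_left h4 hN0]
  have hsN : t + 1 ≤ N := by
    have : 4 ≤ N := by exact_mod_cast (by linarith : (4 : ℝ) ≤ N)
    omega
  have hlow : δ / (16 * r) ≤ binomTail N ((1 + q) / 2) (t + 1) := by
    have h1 := binomTail_le_four_mul (N := N) (s := t) (h := (1 + q) / 2) (by linarith)
      hhq.2 hst hsN
    have h2 : δ / (16 * r) = δ / (4 * r) / 4 := by field_simp; norm_num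
    rw [h2]
    linarith
  -- If one mean surplus `N p_j` exceeds `3d/2`, that index alone reaches `s` with high probability.
  -- Otherwise many indices must contribute together.
  by_cases hlarge : ∃ j, 3 / 2 * d < N * p j
  · obtain ⟨j, hj⟩ := hlarge
    have hqj : q ≤ p j := by
      have : N * q ≤ N * p j := by linarith [mul_pos hN0 hq0]
      exact le_of_mul_le_mul_left this hN0
    have h1 := one_sub_binomTail_le_of_le_mean_sub (N := N) (s := t + 1) (a := N * q / 6)
      (hhi j).1 (hhi j).2 (by positivity) (by linarith [mul_pos hN0 hq0])
    have h4 : (N * q / 6) ^ 2 = N * (N * q ^ 2) / 36 := by ring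
    have h5 : 1 - binomTail N ((1 + p j) / 2) (t + 1) ≤ δ / 2 := by
      rw [h4] at h1
      have h6 : N * q ^ 2 * (1 - binomTail N ((1 + p j) / 2) (t + 1)) ≤ 9 := by
        refine le_of_mul_le_mul_left ?_ hN0
        linarith
      have h7 : N * q ^ 2 * (1 - binomTail N ((1 + p j) / 2) (t + 1)) ≤ N * q ^ 2 * (δ / 2) := by
        linarith
      exact le_of_mul_le_mul_left h7 (by positivity)
    calc _ = (if p j < q then 1 else 1 - binomTail N ((1 + p j) / 2) (t + 1)) *
          ∏ i ∈ Finset.univ.erase j, (if p i < q then 1 else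
            1 - binomTail N ((1 + p i) / 2) (t + 1)) :=
          (Finset.mul_prod_erase _ _ (Finset.mem_univ j)).symm
      _ ≤ (if p j < q then 1 else 1 - binomTail N ((1 + p j) / 2) (t + 1)) * 1 :=
          mul_le_mul_of_nonneg_left (Finset.prod_le_one (fun i _ => (hfac i).1)
            fun i _ => (hfac i).2) (hfac j).1
      _ ≤ δ / 2 := by rw [mul_one, if_neg (not_lt.2 hqj)]; exact h5
  · push Not at hlarge
    set B := binomTail N ((1 + q) / 2) (t + 1) with hB
    have hB0 : 0 ≤ B := binomTail_nonneg hhq.1 hhq.2 _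
    have hd0 : 0 ≤ d := le_trans (by positivity) hdq
    have hterm : ∀ i, (if p i < q then 1 else 1 - binomTail N ((1 + p i) / 2) (t + 1)) ≤
        Real.exp (-((p i / 2 - q) * (d / 4) * B)) := by
      intro i
      by_cases hi : p i / 2 < q
      · refine (hfac i).2.trans (Real.one_le_exp ?_)
        have : (p i / 2 - q) * (d / 4) * B ≤ 0 :=
          mul_nonpos_of_nonpos_of_nonneg
            (mul_nonpos_of_nonpos_of_nonneg (by linarith) (by linarith)) hB0
        linarith
      · have hi' : q ≤ p i / 2 := not_lt.1 hi
        rw [if_neg (by linarith)]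
        -- The comparison uses `p_i / 2` in place of `p_i`: as `N p_i ≤ 3d/2`, its mean surplus
        -- stays below `d` by at least `d/4`, as the likelihood ratio estimate requires.
        have h1 := mul_binomTail_le (N := N) (s := t + 1) hq0.le hi' (by linarith [hp1 i])
          (by linarith [hlarge i])
        have h2 := binomTail_mono (N := N) (h := (1 + p i / 2) / 2) (h' := (1 + p i) / 2)
          (by linarith) (by linarith [hp0 i]) (hhi i).2 (t + 1)
        have h3 : (p i / 2 - q) * (d / 4) * B ≤
            (p i / 2 - q) * (2 * ((t + 1 : ℕ) : ℝ) - N - N * (p i / 2)) * B :=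
          mul_le_mul_of_nonneg_right (mul_le_mul_of_nonneg_left (by linarith [hlarge i])
            (by linarith)) hB0
        have h4 := Real.add_one_le_exp (-((p i / 2 - q) * (d / 4) * B))
        linarith
    -- `∑ (p_i/2 - q) = 1/2 - 1/4`. The sum runs over all indices; the negative terms are covered by
    -- the trivial bound `1` on their factors.
    have hsum : ∑ i, (p i / 2 - q) * (d / 4) * B = d * B / 16 := by
      rw [← Finset.sum_mul, ← Finset.sum_mul, Finset.sum_sub_distrib,
        ← Finset.sum_div, hp,
        Finset.sum_const, Finset.card_univ, Fintype.card_fin, nsmul_eq_mul, mul_comm (r : ℝ) q, hqr]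
      ring
    have hx : 2 / δ ≤ d * B / 16 := by
      have h1 : 3 / 4 * (N * q) * (δ / (16 * r)) ≤ d * B :=
        mul_le_mul hdq hlow (by positivity) hd0
      have h2 : 3 / 4 * (N * q) * (δ / (16 * r)) = 3 * (N * δ ^ 2) / (256 * r ^ 2 * δ) := by
        rw [hq]; field_simp; norm_num
      have h3 : 2 / δ * 16 ≤ 3 * (N * δ ^ 2) / (256 * r ^ 2 * δ) := by
        rw [div_mul_eq_mul_div, div_le_div_iff₀ hδ₀ (by positivity)]
        linarith [mul_le_mul_of_nonneg_right hNδ hδ₀.le, mul_pos (pow_pos hr0 2) hδ₀]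
      linarith
    calc _ ≤ ∏ i, Real.exp (-((p i / 2 - q) * (d / 4) * B)) :=
          Finset.prod_le_prod (fun i _ => (hfac i).1) fun i _ => hterm i
      _ = Real.exp (-(d * B / 16)) := by
          rw [← Real.exp_sum, Finset.sum_neg_distrib, hsum]
      _ ≤ Real.exp (-(2 / δ)) := Real.exp_le_exp.2 (by linarith)
      _ = (Real.exp (2 / δ))⁻¹ := Real.exp_neg _
      _ ≤ (2 / δ)⁻¹ := inv_anti₀ (by positivity) (by linarith [Real.add_one_le_exp (2 / δ)])
      _ = δ / 2 := inv_div _ _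

/-! ### Counts of independent outcomes -/

/-- The number of successes in independent trials is binomial: splitting off the first trial
reproduces the recursion `binomExp_succ`. -/
theorem sum_prod_mul_card_filter {α : Type} [Fintype α] (w : α → ℝ) (hw : ∑ a, w a = 1)
    (E : α → Prop) [DecidablePred E] (N : ℕ) (F : ℕ → ℝ) :
    ∑ f : Fin N → α, (∏ s, w (f s)) * F (Finset.univ.filter fun s => E (f s)).card =
      binomExp N (∑ a, if E a then w a else 0) F := by
  induction N generalizing F with
  | zero => simp [binomExp_zero]
  | succ N ih =>
    set h := ∑ a, if E a then w a else 0 with hh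
    have hsum : ∀ f : Fin (N + 1) → α, (Finset.univ.filter fun s => E (f s)).card =
        (if E (f 0) then 1 else 0) + (Finset.univ.filter fun s : Fin N => E (f s.succ)).card := by
      intro f
      rw [Finset.card_filter, Finset.card_filter, Fin.sum_univ_succ]
    rw [← (Fin.consEquiv fun _ => α).sum_comp, Fintype.sum_prod_type]
    simp only [hsum, Fin.consEquiv_apply, Fin.cons_zero, Fin.cons_succ, Fin.prod_univ_succ]
    have h1 : ∀ a, ∑ f : Fin N → α, w a * (∏ s, w (f s)) *
        F ((if E a then 1 else 0) + (Finset.univ.filter fun s => E (f s)).card) =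
        (if E a then w a else 0) * binomExp N h (fun m => F (m + 1)) +
          (w a - if E a then w a else 0) * binomExp N h F := by
      intro a
      simp only [mul_assoc, ← Finset.mul_sum]
      split_ifs with ha
      · rw [← ih fun m => F (m + 1)]
        simp only [add_comm 1]
        ring
      · rw [← ih F]
        simp only [zero_add]
        ring
    simp only [h1]
    rw [Finset.sum_add_distrib, ← Finset.sum_mul, ← Finset.sum_mul, Finset.sum_sub_distrib,
      hw, ← hh, binomExp_succ]

theorem toReal_indep_apply {ι α : Type} [Fintype ι] [Fintype α] (p : ι → PMF α) (f : ι → α) :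
    (indep p f).toReal = ∏ i, (p i (f i)).toReal := by
  have := Classical.decEq ι
  exact ENNReal.toReal_prod _ _

theorem sum_toReal {α : Type} [Fintype α] (p : PMF α) : ∑ a, (p a).toReal = 1 := by
  rw [← ENNReal.toReal_sum fun a _ => p.apply_ne_top a]
  have := p.tsum_coe
  rw [tsum_fintype] at this
  rw [this, ENNReal.toReal_one]

section Counts

variable {α : Type} [Fintype α] {r N : ℕ} (p : Fin r → PMF α) (E : α → Prop) [DecidablePred E]

/-- The probability of the event `E`. -/
def eventProb (p : PMF α) (E : α → Prop) [DecidablePred E] : ℝ :=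
  ∑ a, if E a then (p a).toReal else 0

/-- Different indices use disjoint blocks of shots, so the counts are independent and the
expectation factors. -/
theorem indep_expect_prod_count (F : Fin r → ℕ → ℝ) :
    ∑ o, (indep (fun x : Fin r × Fin N => p x.1) o).toReal *
      ∏ i, F i (Finset.univ.filter fun s => E (o (i, s))).card =
      ∏ i, binomExp N (eventProb (p i) E) (F i) := by
  simp only [toReal_indep_apply, eventProb,
    ← sum_prod_mul_card_filter _ (sum_toReal (p _)) E N (F _)]
  rw [Finset.prod_univ_sum, Fintype.piFinset_univ, ← (Equiv.curry (Fin r) (Fin N) α).symm.sum_comp]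
  refine Finset.sum_congr rfl fun f _ => ?_
  rw [Finset.prod_mul_distrib, Fintype.prod_prod_type]
  rfl

theorem indep_expect_count (i : Fin r) (F : ℕ → ℝ) :
    ∑ o, (indep (fun x : Fin r × Fin N => p x.1) o).toReal *
      F (Finset.univ.filter fun s => E (o (i, s))).card = binomExp N (eventProb (p i) E) F := by
  have h := indep_expect_prod_count (N := N) p E fun j m => if j = i then F m else 1
  have h1 : ∀ G : Fin r → ℝ, (∏ j, if j = i then G j else 1) = G i := fun G => by
    rw [Finset.prod_ite_eq' Finset.univ i G, if_pos (Finset.mem_univ i)]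
  simp only [h1] at h
  rw [h, Finset.prod_eq_single i]
  · simp
  · intro j _ hj
    simp [hj, binomExp_one]
  · simp

end Counts

/-! ### Markov's inequality and the composition of two random stages. -/

/-- Markov's inequality. -/
theorem le_toOuterMeasure_of_expect {α : Type} [Fintype α] (D : PMF α) (S : Set α) (W : α → ℝ)
    (hW0 : ∀ a, 0 ≤ W a) (hW1 : ∀ a, a ∉ S → 1 ≤ W a) :
    ENNReal.ofReal (1 - ∑ a, (D a).toReal * W a) ≤ D.toOuterMeasure S := by
  classical
  rw [PMF.toOuterMeasure_apply, tsum_fintype]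
  have h1 : ∀ a, S.indicator D a = ENNReal.ofReal (if a ∈ S then (D a).toReal else 0) := by
    intro a
    by_cases ha : a ∈ S
    · simp [ha, ENNReal.ofReal_toReal (D.apply_ne_top a)]
    · simp [ha]
  simp only [h1]
  rw [← ENNReal.ofReal_sum_of_nonneg fun a _ => by split_ifs <;> positivity]
  refine ENNReal.ofReal_le_ofReal ?_
  rw [← sum_toReal D, ← Finset.sum_sub_distrib]
  refine Finset.sum_le_sum fun a _ => ?_
  have h2 : 0 ≤ (D a).toReal := ENNReal.toReal_nonneg
  split_ifs with ha
  · nlinarith [hW0 a]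
  · nlinarith [hW1 a ha]

/-- If the first stage succeeds with probability at least `1 - a`, and after each success the
second stage succeeds with probability at least `1 - b`, both succeed with probability at least
`1 - a - b`. -/
theorem le_toOuterMeasure_bind {α β : Type} (D : PMF α) (f : α → PMF β) (S : Set α) (T : Set β)
    {a b : ℝ} (ha : 0 ≤ a) (hb : 0 ≤ b) (hb1 : b ≤ 1)
    (hS : ENNReal.ofReal (1 - a) ≤ D.toOuterMeasure S)
    (hT : ∀ x ∈ S, ENNReal.ofReal (1 - b) ≤ (f x).toOuterMeasure T) :
    ENNReal.ofReal (1 - (a + b)) ≤ (D.bind f).toOuterMeasure T := by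
  rw [PMF.toOuterMeasure_bind_apply]
  calc ENNReal.ofReal (1 - (a + b)) ≤ ENNReal.ofReal ((1 - a) * (1 - b)) :=
        ENNReal.ofReal_le_ofReal (by nlinarith)
    _ = ENNReal.ofReal (1 - a) * ENNReal.ofReal (1 - b) := ENNReal.ofReal_mul' (by linarith)
    _ ≤ D.toOuterMeasure S * ENNReal.ofReal (1 - b) := mul_le_mul_left hS _
    _ = ∑' x, S.indicator D x * ENNReal.ofReal (1 - b) := by
        rw [PMF.toOuterMeasure_apply, ENNReal.tsum_mul_right]
    _ ≤ _ := by
        refine ENNReal.tsum_le_tsum fun x => ?_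
        by_cases hx : x ∈ S
        · rw [Set.indicator_of_mem hx]
          exact mul_le_mul_right (hT x hx) _
        · simp [hx]

/-! ### The two steps of the read-out -/

theorem argmax_spec {r : ℕ} [NeZero r] (f : Fin r → ℝ) (i : Fin r) : f i ≤ f (argmax f) :=
  (Finite.exists_max f).choose_spec i

/-- With `ŷ = ‖y‖⁻¹ • y`, one has `‖x‖ (ŷ - x̂) = (‖x‖ - ‖y‖) ŷ + (y - x)`, and both terms are at
most `‖y - x‖`. This stays true for `y = 0`, where `ŷ = 0`, so vanishing estimates need no separate
treatment. -/
theorem norm_normalize_sub_le {E : Type*} [NormedAddCommGroup E] [NormedSpace ℝ E] (x y : E)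
    (hx : x ≠ 0) : ‖x‖ * ‖‖y‖⁻¹ • y - ‖x‖⁻¹ • x‖ ≤ 2 * ‖y - x‖ := by
  have hx0 : ‖x‖ ≠ 0 := norm_ne_zero_iff.2 hx
  have h1 : ‖x‖ • (‖y‖⁻¹ • y - ‖x‖⁻¹ • x) = (‖x‖ - ‖y‖) • (‖y‖⁻¹ • y) + (y - x) := by
    have h2 : ‖y‖ • ‖y‖⁻¹ • y = y := by
      rcases eq_or_ne y 0 with rfl | hy
      · simp
      · rw [smul_smul, mul_inv_cancel₀ (norm_ne_zero_iff.2 hy), one_smul]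
    rw [smul_sub, sub_smul, h2, smul_smul ‖x‖ ‖x‖⁻¹, mul_inv_cancel₀ hx0, one_smul]
    abel
  have h3 : ‖‖y‖⁻¹ • y‖ ≤ 1 := by
    rw [norm_smul, norm_inv, norm_norm]
    exact inv_mul_le_one
  calc ‖x‖ * ‖‖y‖⁻¹ • y - ‖x‖⁻¹ • x‖ = ‖(‖x‖ - ‖y‖) • (‖y‖⁻¹ • y) + (y - x)‖ := by
        rw [← h1, norm_smul, norm_norm]
    _ ≤ |‖x‖ - ‖y‖| * ‖‖y‖⁻¹ • y‖ + ‖y - x‖ := by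
        refine (norm_add_le _ _).trans ?_
        rw [norm_smul, Real.norm_eq_abs]
    _ ≤ |‖x‖ - ‖y‖| * 1 + ‖y - x‖ := by gcongr
    _ ≤ 2 * ‖y - x‖ := by
        have := abs_norm_sub_norm_le x y
        rw [norm_sub_rev] at this
        linarith

/-- Stability of the normalization of estimates `b_i ≈ α_k α_i` of a unit vector `α`. -/
theorem sum_sq_normalize_sub_le {r : ℕ} (α b : Fin r → ℝ) (hα : ∑ i, α i ^ 2 = 1) (k : Fin r)
    (hk : α k ≠ 0) {ε : ℝ} (hb : 4 * ∑ i, (b i - α k * α i) ^ 2 ≤ ε ^ 2 * α k ^ 2) :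
    ∑ i, (normalize b i - (SignType.sign (α k) : ℝ) * α i) ^ 2 ≤ ε ^ 2 := by
  set x : EuclideanSpace ℝ (Fin r) := WithLp.toLp 2 fun i => α k * α i with hx
  set y : EuclideanSpace ℝ (Fin r) := WithLp.toLp 2 b with hy
  have hxn : ‖x‖ = |α k| := by
    rw [EuclideanSpace.norm_eq]
    simp only [hx, Real.norm_eq_abs, sq_abs, mul_pow, ← Finset.mul_sum, hα, mul_one]
    exact Real.sqrt_sq_eq_abs _
  have hx0 : x ≠ 0 := by
    rw [← norm_ne_zero_iff, hxn]
    exact abs_ne_zero.2 hk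
  have hyn : ‖y‖ = Real.sqrt (∑ j, b j ^ 2) := by
    rw [EuclideanSpace.norm_eq]
    simp [hy]
  have h1 := norm_normalize_sub_le x y hx0
  have h2 : ‖‖y‖⁻¹ • y - ‖x‖⁻¹ • x‖ ^ 2 =
      ∑ i, (normalize b i - (SignType.sign (α k) : ℝ) * α i) ^ 2 := by
    rw [EuclideanSpace.real_norm_sq_eq]
    refine Finset.sum_congr rfl fun i _ => ?_
    congr 1
    rw [hyn, hxn]
    simp only [hx, hy, PiLp.sub_apply, PiLp.smul_apply, smul_eq_mul, normalize]
    have h3 : |α k|⁻¹ * α k = SignType.sign (α k) := by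
      rw [inv_mul_eq_iff_eq_mul₀ (abs_ne_zero.2 hk), abs_mul_sign]
    rw [← h3]
    ring
  have h4 : ‖y - x‖ ^ 2 = ∑ i, (b i - α k * α i) ^ 2 := by
    rw [EuclideanSpace.real_norm_sq_eq]
    rfl
  have h5 : (‖x‖ * ‖‖y‖⁻¹ • y - ‖x‖⁻¹ • x‖) ^ 2 ≤ (2 * ‖y - x‖) ^ 2 :=
    pow_le_pow_left₀ (by positivity) h1 2
  rw [mul_pow, mul_pow, h2, h4, hxn, sq_abs] at h5
  have h6 : 0 < α k ^ 2 := by positivity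
  refine le_of_mul_le_mul_left ?_ h6
  linarith

section Steps

variable {m n r : ℕ} {A : Matrix (Fin m) (Fin n) ℝ} {g : Fin r → Fin m}

theorem eventProb_swapTest (h : LinearIndependent ℝ fun i => row A (g i))
    {v : EuclideanSpace ℝ (Fin n)} (hv : ‖v‖ = 1) (i : Fin r) :
    eventProb (swapTest (QState.ofReal v hv) (orthoState A g h i)) (fun x => x = 0) =
      (1 + ⟪orthoRow A g i, v⟫_ℝ ^ 2) / 2 := by
  rw [eventProb, Finset.sum_ite_eq' Finset.univ (0 : Fin 2), if_pos (Finset.mem_univ _)]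
  exact swapTest_zero v _ hv (norm_orthoRow h i)

theorem eventProb_signTest (h : LinearIndependent ℝ fun i => row A (g i))
    {v : EuclideanSpace ℝ (Fin n)} (hv : ‖v‖ = 1) (k i : Fin r) :
    eventProb (signTest (QState.ofReal v hv) ((orthoState A g h k).flagged (orthoState A g h i)))
      (fun x => x.1 = x.2) = (1 + ⟪orthoRow A g k, v⟫_ℝ * ⟪orthoRow A g i, v⟫_ℝ) / 2 :=
  signTest_equal v _ _ hv (norm_orthoRow h k) (norm_orthoRow h i)

/-- The first step finds an index with a large overlap. -/
theorem le_toOuterMeasure_firstStep [NeZero r] (R : Implementation m n r) (hA : A.rank = r)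
    (h : LinearIndependent ℝ fun i => row A (g i)) {v : EuclideanSpace ℝ (Fin n)} (hv : ‖v‖ = 1)
    (hvA : v ∈ Submodule.span ℝ (Set.range (row A))) {δ : ℝ} (hδ₀ : 0 < δ) (hδ₁ : δ < 1)
    (hN : 4096 * (r : ℝ) ^ 2 / δ ^ 2 ≤ R.shots₁) :
    ENNReal.ofReal (1 - 3 / 4 * δ) ≤
      (indep fun p : Fin r × Fin R.shots₁ =>
        swapTest (QState.ofReal v hv) (orthoState A g h p.1)).toOuterMeasure
      {o | 1 / (4 * r) ≤ ⟪orthoRow A g (argmax (R.estimate₁ o)), v⟫_ℝ ^ 2} := by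
  have hr : 0 < r := NeZero.pos r
  have hr0 : (0 : ℝ) < r := by exact_mod_cast hr
  have hN0 : (0 : ℝ) < R.shots₁ := lt_of_lt_of_le (by positivity) hN
  set p : Fin r → ℝ := fun i => ⟪orthoRow A g i, v⟫_ℝ ^ 2 with hp
  obtain ⟨s, hs⟩ := exists_threshold hr p (fun i => sq_nonneg _)
    (sum_sq_inner_orthoRow hA h hvA hv) hδ₀ hδ₁ hN
  set c : (Fin r × Fin R.shots₁ → Fin 2) → Fin r → ℕ := fun o i =>
    (Finset.univ.filter fun s => o (i, s) = 0).card with hc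
  -- The Markov weight counts the bad indices that reach `s` and adds the indicator that no good
  -- index does. If the index of the largest count is bad, then either it reaches `s` itself or no
  -- index does, so the weight is at least `1`.
  refine le_trans (ENNReal.ofReal_le_ofReal ?_) (le_toOuterMeasure_of_expect _ _ (fun o =>
    (∑ i, if p i < 1 / (4 * r) then (if s ≤ c o i then 1 else 0) else 0) +
      ∏ i, if p i < 1 / (4 * r) then 1 else (if c o i < s then 1 else 0)) (fun o => ?_)
      (fun o ho => ?_))
  · have h1 : ∀ i, ∑ o, (indep (fun p : Fin r × Fin R.shots₁ =>
        swapTest (QState.ofReal v hv) (orthoState A g h p.1)) o).toReal *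
        (if p i < 1 / (4 * r) then (if s ≤ c o i then 1 else 0) else 0) =
        if p i < 1 / (4 * r) then binomTail R.shots₁ ((1 + p i) / 2) s else 0 := by
      intro i
      split_ifs
      · rw [binomTail, hp, ← eventProb_swapTest h hv i]
        exact indep_expect_count (fun i => swapTest (QState.ofReal v hv) (orthoState A g h i))
          (fun x => x = 0) i fun m => if s ≤ m then 1 else 0
      · simp
    have h2 : ∑ o, (indep (fun p : Fin r × Fin R.shots₁ =>
        swapTest (QState.ofReal v hv) (orthoState A g h p.1)) o).toReal *
        (∏ i, if p i < 1 / (4 * r) then 1 else (if c o i < s then 1 else 0)) =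
        ∏ i, if p i < 1 / (4 * r) then 1 else 1 - binomTail R.shots₁ ((1 + p i) / 2) s := by
      refine (indep_expect_prod_count (fun i => swapTest (QState.ofReal v hv) (orthoState A g h i))
          (fun x => x = 0) fun i m => if p i < 1 / (4 * r) then 1 else
            (if m < s then 1 else 0)).trans ?_
      refine Finset.prod_congr rfl fun i _ => ?_
      rw [eventProb_swapTest h hv i]
      split_ifs
      · exact binomExp_one _ _
      · rw [one_sub_binomTail]
    simp only [mul_add, Finset.sum_add_distrib, Finset.mul_sum]
    rw [h2, Finset.sum_comm]
    simp only [h1]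
    linarith
  · refine add_nonneg (Finset.sum_nonneg fun i _ => ?_) (Finset.prod_nonneg fun i _ => ?_) <;>
      split_ifs <;> norm_num
  · have hk : p (argmax (R.estimate₁ o)) < 1 / (4 * r) := not_le.1 ho
    set k := argmax (R.estimate₁ o) with hkdef
    have hmax : ∀ j, c o j ≤ c o k := by
      intro j
      have h1 := argmax_spec (R.estimate₁ o) j
      rw [← hkdef] at h1
      have h2 : 2 * ((c o j : ℝ) / R.shots₁) - 1 ≤ 2 * ((c o k : ℝ) / R.shots₁) - 1 := h1
      have h3 : (c o j : ℝ) / R.shots₁ ≤ (c o k : ℝ) / R.shots₁ := by linarith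
      exact_mod_cast (div_le_div_iff_of_pos_right hN0).1 h3
    have hnn : ∀ i, (0 : ℝ) ≤ if p i < 1 / (4 * r) then (if s ≤ c o i then 1 else 0) else 0 := by
      intro i
      split_ifs <;> norm_num
    by_cases hsk : s ≤ c o k
    · have h1 := Finset.single_le_sum (fun i _ => hnn i) (Finset.mem_univ k)
      rw [if_pos hk, if_pos hsk] at h1
      have h2 : (0 : ℝ) ≤ ∏ i, if p i < 1 / (4 * r) then 1 else (if c o i < s then 1 else 0) :=
        Finset.prod_nonneg fun i _ => by split_ifs <;> norm_num
      linarith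
    · have h1 : ∏ i, (if p i < 1 / (4 * r) then (1 : ℝ) else (if c o i < s then 1 else 0)) = 1 := by
        refine Finset.prod_eq_one fun i _ => ?_
        rw [if_pos ((hmax i).trans_lt (not_le.1 hsk)), ite_self]
      rw [h1]
      linarith [Finset.sum_nonneg fun i (_ : i ∈ Finset.univ) => hnn i]

/-- The second step estimates all products of overlaps with small total square error. -/
theorem le_toOuterMeasure_secondStep (R : Implementation m n r) (hr : 0 < r)
    (h : LinearIndependent ℝ fun i => row A (g i)) {v : EuclideanSpace ℝ (Fin n)} (hv : ‖v‖ = 1)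
    (k : Fin r) {ε δ : ℝ} (hε : 0 < ε) (hδ : 0 < δ)
    (hN : 16 * (r : ℝ) ^ 2 / (δ * ε ^ 2) ≤ R.shots₂) :
    ENNReal.ofReal (1 - δ) ≤
      (indep fun p : Fin r × Fin R.shots₂ => signTest (QState.ofReal v hv)
        ((orthoState A g h k).flagged (orthoState A g h p.1))).toOuterMeasure
      {o | 4 * ∑ i, (R.estimate₂ o i - ⟪orthoRow A g k, v⟫_ℝ * ⟪orthoRow A g i, v⟫_ℝ) ^ 2 ≤
        ε ^ 2 * (1 / (4 * r))} := by
  have hr0 : (0 : ℝ) < r := by exact_mod_cast hr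
  have hN0 : (0 : ℝ) < R.shots₂ := lt_of_lt_of_le (by positivity) hN
  -- The factor `16r/ε²` makes the weight exceed `1` exactly when the accuracy condition fails.
  refine le_trans (ENNReal.ofReal_le_ofReal ?_) (le_toOuterMeasure_of_expect _ _ (fun o =>
    16 * r / ε ^ 2 * ∑ i, (R.estimate₂ o i - ⟪orthoRow A g k, v⟫_ℝ * ⟪orthoRow A g i, v⟫_ℝ) ^ 2)
      (fun o => ?_) (fun o ho => ?_))
  · have h1 : ∀ i, ∑ o, (indep (fun p : Fin r × Fin R.shots₂ => signTest (QState.ofReal v hv)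
        ((orthoState A g h k).flagged (orthoState A g h p.1))) o).toReal *
        (R.estimate₂ o i - ⟪orthoRow A g k, v⟫_ℝ * ⟪orthoRow A g i, v⟫_ℝ) ^ 2 ≤
        1 / R.shots₂ := by
      intro i
      set x := ⟪orthoRow A g k, v⟫_ℝ * ⟪orthoRow A g i, v⟫_ℝ
      have h2 := indep_expect_count (N := R.shots₂) (fun i => signTest (QState.ofReal v hv)
        ((orthoState A g h k).flagged (orthoState A g h i))) (fun x => x.1 = x.2) i
        fun m => (2 * ((m : ℝ) / R.shots₂) - 1 - x) ^ 2
      rw [eventProb_signTest h hv k i] at h2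
      refine h2.trans_le ?_
      have h3 : (fun m : ℕ => (2 * ((m : ℝ) / R.shots₂) - 1 - x) ^ 2) =
          fun m : ℕ => (4 / (R.shots₂ : ℝ) ^ 2) * ((m : ℝ) - R.shots₂ * ((1 + x) / 2)) ^ 2 := by
        funext m
        field_simp
        ring
      rw [h3, binomExp_const_mul, binomExp_sq_sub, sub_self]
      have h4 := mul_le_mul_of_nonneg_left (mul_one_sub_le_quarter ((1 + x) / 2)) hN0.le
      calc _ ≤ 4 / (R.shots₂ : ℝ) ^ 2 * (R.shots₂ * (1 / 4) + 0 ^ 2) := by gcongr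
        _ = 1 / R.shots₂ := by field_simp; ring
    have h5 : ∑ o, (indep (fun p : Fin r × Fin R.shots₂ => signTest (QState.ofReal v hv)
        ((orthoState A g h k).flagged (orthoState A g h p.1))) o).toReal * (16 * r / ε ^ 2 *
        ∑ i, (R.estimate₂ o i - ⟪orthoRow A g k, v⟫_ℝ * ⟪orthoRow A g i, v⟫_ℝ) ^ 2) ≤ δ := by
      calc _ = 16 * r / ε ^ 2 * ∑ i, ∑ o, (indep (fun p : Fin r × Fin R.shots₂ =>
            signTest (QState.ofReal v hv)
            ((orthoState A g h k).flagged (orthoState A g h p.1))) o).toReal *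
            (R.estimate₂ o i - ⟪orthoRow A g k, v⟫_ℝ * ⟪orthoRow A g i, v⟫_ℝ) ^ 2 := by
            rw [Finset.sum_comm, Finset.mul_sum]
            refine Finset.sum_congr rfl fun o _ => ?_
            rw [← Finset.mul_sum]
            ring
        _ ≤ 16 * r / ε ^ 2 * ∑ _i : Fin r, 1 / (R.shots₂ : ℝ) :=
            mul_le_mul_of_nonneg_left (Finset.sum_le_sum fun i _ => h1 i) (by positivity)
        _ = 16 * (r : ℝ) ^ 2 / ε ^ 2 / R.shots₂ := by
            rw [Finset.sum_const, Finset.card_univ, Fintype.card_fin, nsmul_eq_mul]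
            field_simp
        _ ≤ δ := by
            rw [div_le_iff₀ hN0]
            rw [div_le_iff₀ (by positivity)] at hN ⊢
            linarith
    linarith
  · exact mul_nonneg (by positivity) (Finset.sum_nonneg fun i _ => sq_nonneg _)
  · rw [Set.mem_ofPred_eq, not_le, mul_one_div, div_lt_iff₀ (by positivity)] at ho
    rw [div_mul_eq_mul_div, le_div_iff₀ (by positivity), one_mul]
    linarith

/-- The output is accurate when both steps succeed. -/
theorem norm_sum_transition_normalize_sub_le (hA : A.rank = r) (hr : 0 < r)
    (h : LinearIndependent ℝ fun i => row A (g i)) {v : EuclideanSpace ℝ (Fin n)} (hv : ‖v‖ = 1)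
    (hvA : v ∈ Submodule.span ℝ (Set.range (row A))) (b : Fin r → ℝ) (k : Fin r) {ε : ℝ}
    (hε : 0 < ε) (hk : 1 / (4 * (r : ℝ)) ≤ ⟪orthoRow A g k, v⟫_ℝ ^ 2)
    (hb : 4 * ∑ i, (b i - ⟪orthoRow A g k, v⟫_ℝ * ⟪orthoRow A g i, v⟫_ℝ) ^ 2 ≤
      ε ^ 2 * (1 / (4 * r))) :
    ‖∑ i, (transition A g *ᵥ normalize b) i • unitRow A g i -
      (SignType.sign ⟪orthoRow A g k, v⟫_ℝ : ℝ) • v‖ ≤ ε := by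
  have hr0 : (0 : ℝ) < r := by exact_mod_cast hr
  have hk0 : ⟪orthoRow A g k, v⟫_ℝ ≠ 0 := by
    intro h0
    rw [h0] at hk
    have : (0 : ℝ) < 1 / (4 * r) := by positivity
    linarith
  have h1 := sum_sq_normalize_sub_le (fun i => ⟪orthoRow A g i, v⟫_ℝ) b
    (sum_sq_inner_orthoRow hA h hvA hv) k hk0
    (hb.trans (mul_le_mul_of_nonneg_left hk (sq_nonneg ε)))
  -- Multiplication by `Z` changes coordinates from the `t_i` to the rows, so the error is measured
  -- in an orthonormal basis and the conditioning of `C` does not enter.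
  refine le_of_sq_le_sq (le_trans (le_of_eq ?_) h1) hε.le
  rw [← norm_sum_smul_orthoRow_sq h, sum_transition_mulVec h]
  congr 2
  conv_lhs => enter [2, 2]; rw [eq_sum_orthoRow hA h hvA]
  rw [Finset.smul_sum, ← Finset.sum_sub_distrib]
  exact Finset.sum_congr rfl fun i _ => by rw [sub_smul, smul_smul]

end Steps

end QReadout

end

/-! ### Choice of the constants and assembly. -/

theorem theorem3 (δ : ℝ) (hδ₀ : 0 < δ) (hδ₁ : δ < 1) :
    -- `K` depends on `δ` only; the implementation depends only on `δ`, the dimensions, the selected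
    -- row indices, the transformation matrix and the precision, not on `A`, `v` or the oracle
    ∃ (K : ℝ) (alg : ∀ m n r : ℕ, (Fin r → Fin m) → Matrix (Fin r) (Fin r) ℝ → ℝ →
        QReadout.Implementation m n r),
      ∀ (m n r : ℕ) [NeZero m] [NeZero n] [NeZero r] (A : Matrix (Fin m) (Fin n) ℝ)
        (g : Fin r → Fin m) (_hA : A.rank = r)
        (hg : LinearIndependent ℝ fun i => QReadout.row A (g i))
        (v : EuclideanSpace ℝ (Fin n)) (hv : ‖v‖ = 1)
        (_hvA : v ∈ Submodule.span ℝ (Set.range (QReadout.row A)))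
        (ε : ℝ) (_hε₀ : 0 < ε) (_hε₁ : ε < 1),
        -- the preparation circuits are correct for every oracle of the rows of `A`
        (∀ U : Matrix.unitaryGroup (Fin m × Fin n) ℂ, QReadout.IsRowOracle A U →
          (alg m n r g (QReadout.transition A g) ε).Correct U (QReadout.orthoState A g hg)) ∧
        -- the number of copies of `|v⟩`
        ((alg m n r g (QReadout.transition A g) ε).copies : ℝ) ≤ K * (r : ℝ) ^ 3 * ε⁻¹ ^ 2 ∧
        -- the number of oracle queries, whatever index `k` the first step returns
        (∀ k, ((alg m n r g (QReadout.transition A g) ε).queries k : ℝ) ≤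
          K * (r : ℝ) ^ 4 * (QReadout.sigmaMin (QReadout.gramC A g)) ^ (-(1 / 2) : ℝ) *
            ε⁻¹ ^ 2) ∧
        -- the error, where the global sign of `v` is such that its overlap with `t_k` is positive
        ENNReal.ofReal (1 - δ) ≤
          (QReadout.readout (alg m n r g (QReadout.transition A g) ε) (QReadout.transition A g)
              (QReadout.orthoState A g hg) (QReadout.QState.ofReal v hv)).toOuterMeasure
            {p : Fin r × (Fin r → ℝ) |
              ‖∑ i, p.2 i • QReadout.unitRow A g i -
                (SignType.sign (inner ℝ (QReadout.orthoRow A g p.1) v) : ℝ) • v‖ ≤ ε} := by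
  have hc₁ := fun (m n r : ℕ) (g : Fin r → Fin m) (Z : Matrix (Fin r) (Fin r) ℝ) (i : Fin r) =>
    QReadout.exists_circuit_orthoState (n := n) g Z i
  have hc₂ := fun (m n r : ℕ) (g : Fin r → Fin m) (Z : Matrix (Fin r) (Fin r) ℝ) (k i : Fin r) =>
    QReadout.exists_circuit_flagged (n := n) g Z k i
  choose c₁ hc₁ using hc₁
  choose c₂ hc₂ using hc₂
  -- The first step is run with failure parameter `2δ/3`, whence `9216 = 4096 · (3/2)²`, and the
  -- second with `δ/2`, whence `32 = 16 · 2`. The summand `2` pays for the two ceilings and the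
  -- factor `5` for the queries of one circuit.
  refine ⟨5 * (9216 / δ ^ 2 + 32 / δ + 2), fun m n r g Z ε =>
    ⟨⌈9216 * (r : ℝ) ^ 2 / δ ^ 2⌉₊, ⌈32 * (r : ℝ) ^ 2 / (δ * ε ^ 2)⌉₊, c₁ m n r g Z, c₂ m n r g Z⟩,
    ?_⟩
  intro m n r _ _ _ A g hA hg v hv hvA ε hε₀ hε₁
  have hr : 0 < r := NeZero.pos r
  have hr1 : (1 : ℝ) ≤ r := by exact_mod_cast hr
  have hr0 : (0 : ℝ) < r := by linarith
  have hεi : 1 ≤ ε⁻¹ ^ 2 := one_le_pow₀ ((one_le_inv₀ hε₀).2 hε₁.le)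
  have hr2 : 1 ≤ (r : ℝ) ^ 2 * ε⁻¹ ^ 2 := one_le_mul_of_one_le_of_one_le (one_le_pow₀ hr1) hεi
  set N₁ := ⌈9216 * (r : ℝ) ^ 2 / δ ^ 2⌉₊ with hN₁
  set N₂ := ⌈32 * (r : ℝ) ^ 2 / (δ * ε ^ 2)⌉₊ with hN₂
  have hN₁l : 9216 * (r : ℝ) ^ 2 / δ ^ 2 ≤ N₁ := Nat.le_ceil _
  have hN₂l : 32 * (r : ℝ) ^ 2 / (δ * ε ^ 2) ≤ N₂ := Nat.le_ceil _
  have hN : (N₁ : ℝ) + N₂ ≤ (9216 / δ ^ 2 + 32 / δ + 2) * ((r : ℝ) ^ 2 * ε⁻¹ ^ 2) := by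
    have h1 : (N₁ : ℝ) ≤ 9216 * (r : ℝ) ^ 2 / δ ^ 2 + 1 := (Nat.ceil_lt_add_one (by positivity)).le
    have h2 : (N₂ : ℝ) ≤ 32 * (r : ℝ) ^ 2 / (δ * ε ^ 2) + 1 :=
      (Nat.ceil_lt_add_one (by positivity)).le
    have h3 : 9216 * (r : ℝ) ^ 2 / δ ^ 2 ≤ 9216 / δ ^ 2 * ((r : ℝ) ^ 2 * ε⁻¹ ^ 2) := by
      have : 9216 * (r : ℝ) ^ 2 / δ ^ 2 * 1 ≤ 9216 * (r : ℝ) ^ 2 / δ ^ 2 * ε⁻¹ ^ 2 :=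
        mul_le_mul_of_nonneg_left hεi (by positivity)
      calc _ = 9216 * (r : ℝ) ^ 2 / δ ^ 2 * 1 := (mul_one _).symm
        _ ≤ _ := this
        _ = _ := by ring
    have h4 : 32 * (r : ℝ) ^ 2 / (δ * ε ^ 2) = 32 / δ * ((r : ℝ) ^ 2 * ε⁻¹ ^ 2) := by
      field_simp
    linarith
  set s := QReadout.sigmaMin (QReadout.gramC A g) ^ (-(1 / 2) : ℝ) with hs
  have hs0 : 0 ≤ s := by linarith [(QReadout.inv_sqrt_sigmaMin_bounds hr hg).1]
  refine ⟨fun U hU => ⟨fun i => ((hc₁ m n r g _ i A hg rfl).2 U hU), fun k i =>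
    ((hc₂ m n r g _ k i A hg rfl).2 U hU)⟩, ?_, fun k => ?_, ?_⟩
  · calc (((r * N₁ + r * N₂ : ℕ)) : ℝ) = r * (N₁ + N₂) := by push_cast; ring
      _ ≤ r * ((9216 / δ ^ 2 + 32 / δ + 2) * ((r : ℝ) ^ 2 * ε⁻¹ ^ 2)) :=
          mul_le_mul_of_nonneg_left hN hr0.le
      _ = 1 * ((9216 / δ ^ 2 + 32 / δ + 2) * (r : ℝ) ^ 3 * ε⁻¹ ^ 2) := by ring
      _ ≤ 5 * ((9216 / δ ^ 2 + 32 / δ + 2) * (r : ℝ) ^ 3 * ε⁻¹ ^ 2) :=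
          mul_le_mul_of_nonneg_right (by norm_num) (by positivity)
      _ = _ := by ring
  · have h1 : ∀ (N : ℕ) (q : Fin r → ℕ), (∀ i, (q i : ℝ) ≤ 5 * r * s) →
        ((∑ i, N * q i : ℕ) : ℝ) ≤ N * (5 * (r : ℝ) ^ 2 * s) := by
      intro N q hq
      push_cast
      calc ∑ i, (N : ℝ) * q i ≤ ∑ _i : Fin r, (N : ℝ) * (5 * r * s) :=
            Finset.sum_le_sum fun i _ => mul_le_mul_of_nonneg_left (hq i) (Nat.cast_nonneg _)
        _ = _ := by
            rw [Finset.sum_const, Finset.card_univ, Fintype.card_fin, nsmul_eq_mul]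
            ring
    have h2 := h1 N₁ _ fun i => (hc₁ m n r g _ i A hg rfl).1
    have h3 := h1 N₂ _ fun i => (hc₂ m n r g _ k i A hg rfl).1
    have h4 : ((N₁ : ℝ) + N₂) * (5 * (r : ℝ) ^ 2 * s) ≤
        (9216 / δ ^ 2 + 32 / δ + 2) * ((r : ℝ) ^ 2 * ε⁻¹ ^ 2) * (5 * (r : ℝ) ^ 2 * s) :=
      mul_le_mul_of_nonneg_right hN (by positivity)
    rw [QReadout.Implementation.queries, Nat.cast_add]
    refine (add_le_add h2 h3).trans ?_
    calc _ = ((N₁ : ℝ) + N₂) * (5 * (r : ℝ) ^ 2 * s) := by ring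
      _ ≤ _ := h4
      _ = _ := by ring
  -- Each step may fail with probability `δ/2`; the first contributes `3/4` of its parameter `2δ/3`.
  · have hδ : 1 - δ = 1 - (3 / 4 * (2 / 3 * δ) + δ / 2) := by ring
    rw [hδ, QReadout.readout]
    refine QReadout.le_toOuterMeasure_bind _ _ _ _ (by positivity) (by positivity) (by linarith)
      (QReadout.le_toOuterMeasure_firstStep _ hA hg hv hvA (δ := 2 / 3 * δ) (by positivity)
        (by linarith) (le_trans (le_of_eq ?_) hN₁l)) fun o₁ ho₁ => ?_
    · field_simp
      norm_num
    · rw [PMF.toOuterMeasure_map_apply]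
      refine (QReadout.le_toOuterMeasure_secondStep _ hr hg hv _ hε₀ (δ := δ / 2) (by positivity)
        (le_trans (le_of_eq ?_) hN₂l)).trans (MeasureTheory.measure_mono fun o₂ ho₂ => ?_)
      · field_simp
        norm_num
      · exact QReadout.norm_sum_transition_normalize_sub_le hA hr hg hv hvA _ _ hε₀ ho₁ ho₂
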